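/- Let $\Sigma$ be a finite linearly ordered alphabet with $k$ letters. Words of the same length over $\Sigma$ are compared lexicographically. The necklace of a word $w$ is the set of all rotations of $w$, and its representative is its lexicographically smallest element. The bracelet of $w$ is the set of all rotations of $w$ together with the reversals of these rotations; it is the union of the necklace of $w$ and the necklace of the reversal of $w$. A bracelet encloses a word $v$ if it contains two necklaces whose representatives $r$ and $s$ satisfy $r < v < s$. Theorem. The number of bracelets of length $n$ enclosing $v \in \Sigma^n$ can be computed in $O(n^4 k^2)$ time. More precisely: there are a single program for the unit-cost random access machine (natural-number memory cells, indirect addressing, comparison, addition and truncated subtraction at unit cost, no multiplication or division) and a constant $C$ such that for all finite linearly ordered alphabets $\Sigma$, with $k = |\Sigma|$, all $n \ge 1$ and all $v \in \Sigma^n$, the program, given $n$, $k$ and the $n$ letters of $v$ (each encoded as its position $0,\dots,k-1$ in the order of $\Sigma$), halts after at most $C\, n^4 k^2$ steps and outputs the number of bracelets of length $n$ over $\Sigma$ that enclose $v$. -/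

import Mathlib

/-! ### Words, necklaces, bracelets

Words over `A` are lists, ordered lexicographically by Mathlib's order on `List A`; only words of
equal length are ever compared. `u ~r w` is Mathlib's "`w` is a rotation of `u`". -/

namespace Bracelets

/-- The necklace (cyclic word) of `w`: the set of all rotations of `w`. -/
def necklace {A : Type*} (w : List A) : Set (List A) := {u | w.IsRotated u}

/-- The bracelet of `w`: the class of `w` under rotation and reversal, that is, the union of the
necklace of `w` and of the set of the reversals of its elements. -/
def bracelet {A : Type*} (w : List A) : Set (List A) :=
  necklace w ∪ List.reverse '' necklace w

/-- `r` is the necklace representative of the necklace of `w`: its lexicographically smallest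
element. -/
def IsNecklaceRep {A : Type*} [LinearOrder A] (w r : List A) : Prop := IsLeast (necklace w) r

/-- The bracelet `B` encloses `v`: `B` contains two necklaces, one with representative smaller
than `v` and one with representative larger than `v`. -/
def Encloses {A : Type*} [LinearOrder A] (B : Set (List A)) (v : List A) : Prop :=
  ∃ a ∈ B, ∃ b ∈ B, ∃ r s : List A, IsNecklaceRep a r ∧ IsNecklaceRep b s ∧ r < v ∧ v < s

/-- The set of all bracelets of words of length `n` that enclose `v`. -/
def enclosingBracelets {A : Type*} [LinearOrder A] (n : ℕ) (v : List A) :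
    Set (Set (List A)) :=
  {B | (∃ w : List A, w.length = n ∧ B = bracelet w) ∧ Encloses B v}

end Bracelets

/-! ### Unit-cost random access machine

A program works on natural numbers stored in variables `x₀, x₁, …` and in one-dimensional arrays
`M₀, M₁, …`. A given program names finitely many of them. There are no arithmetic operations
besides addition and truncated subtraction. Every constant, variable or array access, every
arithmetic operation, every assignment and every test is charged one time unit. -/

namespace RAM

/-- Expressions: constants, variables, array cells with computed index, sum, truncated
difference. -/
inductive Expr : Type
  | num (c : ℕ)
  | var (x : ℕ)
  | get (a : ℕ) (i : Expr)
  | add (e f : Expr)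
  | sub (e f : Expr)

/-- Contents of the memory. -/
structure State : Type where
  var : ℕ → ℕ
  arr : ℕ → ℕ → ℕ

/-- Value of an expression. -/
def Expr.eval (σ : State) : Expr → ℕ
  | num c => c
  | var x => σ.var x
  | get a i => σ.arr a (i.eval σ)
  | add e f => e.eval σ + f.eval σ
  | sub e f => e.eval σ - f.eval σ

/-- Time for the evaluation of an expression. -/
def Expr.cost : Expr → ℕ
  | num _ => 1
  | var _ => 1
  | get _ i => i.cost + 1
  | add e f => e.cost + f.cost + 1
  | sub e f => e.cost + f.cost + 1

/-- Programs. -/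
inductive Prog : Type
  /-- do nothing -/
  | skip
  /-- `x := e` -/
  | assign (x : ℕ) (e : Expr)
  /-- `M_a[i] := e` -/
  | store (a : ℕ) (i e : Expr)
  /-- `p; q` -/
  | seq (p q : Prog)
  /-- if `e < f` then `p` else `q` -/
  | ifLt (e f : Expr) (p q : Prog)
  /-- while `e < f` do `p` -/
  | whileLt (e f : Expr) (p : Prog)

/-- `σ` with variable `x` set to `m`. -/
def State.setVar (σ : State) (x m : ℕ) : State :=
  { σ with var := Function.update σ.var x m }

/-- `σ` with cell `i` of array `a` set to `m`. -/
def State.setArr (σ : State) (a i m : ℕ) : State :=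
  { σ with arr := Function.update σ.arr a (Function.update (σ.arr a) i m) }

/-- `Run p σ τ t`: started in `σ`, the program `p` halts in `τ` after exactly `t` time units. -/
inductive Run : Prog → State → State → ℕ → Prop
  | skip (σ : State) : Run .skip σ σ 1
  | assign (σ : State) (x : ℕ) (e : Expr) :
      Run (.assign x e) σ (σ.setVar x (e.eval σ)) (e.cost + 1)
  | store (σ : State) (a : ℕ) (i e : Expr) :
      Run (.store a i e) σ (σ.setArr a (i.eval σ) (e.eval σ)) (i.cost + e.cost + 1)
  | seq {p q : Prog} {σ τ υ : State} {t u : ℕ} (hp : Run p σ τ t) (hq : Run q τ υ u) :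
      Run (.seq p q) σ υ (t + u)
  | ifTrue {e f : Expr} {p q : Prog} {σ τ : State} {t : ℕ} (h : e.eval σ < f.eval σ)
      (hp : Run p σ τ t) : Run (.ifLt e f p q) σ τ (e.cost + f.cost + 1 + t)
  | ifFalse {e f : Expr} {p q : Prog} {σ τ : State} {t : ℕ} (h : ¬ e.eval σ < f.eval σ)
      (hq : Run q σ τ t) : Run (.ifLt e f p q) σ τ (e.cost + f.cost + 1 + t)
  | whileTrue {e f : Expr} {p : Prog} {σ τ υ : State} {t u : ℕ} (h : e.eval σ < f.eval σ)
      (hp : Run p σ τ t) (hw : Run (.whileLt e f p) τ υ u) :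
      Run (.whileLt e f p) σ υ (e.cost + f.cost + 1 + t + u)
  | whileFalse {e f : Expr} {p : Prog} {σ : State} (h : ¬ e.eval σ < f.eval σ) :
      Run (.whileLt e f p) σ σ (e.cost + f.cost + 1)

/-- The code of a letter: the number of letters smaller than it. -/
def letterCode {A : Type*} [LinearOrder A] [Fintype A] (a : A) : ℕ :=
  (Finset.univ.filter (fun b : A => b < a)).card

/-- Initial memory for the input word `v` over the alphabet `A`: the length of `v` in variable
`0`, the size of the alphabet in variable `1`, the codes of the letters of `v` in the cells
`0, …, |v| - 1` of array `0`, and zero everywhere else. -/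
def inputState {A : Type*} [LinearOrder A] [Fintype A] (v : List A) : State where
  var := fun x => if x = 0 then v.length else if x = 1 then Fintype.card A else 0
  arr := fun a i => if a = 0 then (v.map letterCode).getD i 0 else 0

end RAM

/-!
# Counting the bracelets that enclose a word in time `O(n ^ 4 * k ^ 2)`

Letters are represented by their codes `0, …, k - 1`.

*Reduction to words.* A bracelet consists of the necklace of a word `w` and the necklace of its
reversal. It encloses `v` exactly when one of the two has a rotation smaller than `v` while all
rotations of the other are larger than `v`, and only one of the two can play the first role. So
the number sought is the number of necklaces in the set of the words `w` that have a rotation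
smaller than `v` and whose reversals have only rotations larger than `v`
(`ncard_enclosingBracelets`). By Burnside's lemma this number, times `n`, is the sum over
`j < n` of the number of words in this set that are fixed by the rotation by `j`; these are the
powers of words of length `gcd j n` (`sum_card_closedWords`). "Larger than `v`" is the same as "at
least `v⁺`", where the last letter of `v` is increased by one (`bump`). It remains to count, for
every length `d ≤ n`, the words `u` such that all suffixes of `u u u …` are at least `v`, up to the
length `n`, and likewise for the reversal of `u` and `v⁺`.

*Lyndon roots.* Duval's algorithm finds a prefix `x` of `v` that is a Lyndon word, such that "all
factors of length `n` are at least `v`" is equivalent to "all suffixes are at least `x x x …`"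
(`IsLyndonRoot.factorsGe_iff`). The second condition is checked by an automaton whose state is the
length, modulo `|x|`, of the current match with `x x x …`: a letter larger than expected leads to
state `0`, a smaller one is rejected. Since a Lyndon word has no border, two runs on the same
infinite word agree eventually (`IsRun.eventually_eq`). Hence `u` satisfies the condition if and
only if the automaton has a closed run on `u` (`closed_iff_suffixesGe`), and this run is unique
(`closed_run_unique`).

*Counting.* Running one automaton forwards and the other one backwards, one has to count the closed
walks of length `d` in a product with at most `n ^ 2` states. Starting at all of them would be too
slow. But every closed walk visits state `0` of the forward automaton, so it is enough to start at
the at most `n` pairs `(0, q)`, if each walk is counted with the time of its first return to state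
`0` of the forward automaton: this is the number of rotations of the walk for which that visit is
the last one before the new origin (`sum_walks_eq_card`). The weighted numbers satisfy a linear
recurrence in the length (`walks_succ`, `walksNoReturn_succ`). For each of the `n` initial pairs
and each of the `n` lengths, it is evaluated with one operation for each of at most `n ^ 2` pairs
of states and each of `k` letters, which gives `O(n ^ 4 * k)` steps in total. The words with
no condition on their own rotations are counted by the same program, for the Lyndon word `0`.

The final division by `n` uses the numbers `n * 2 ^ j` with `j ≤ n * k`.

*Memory layout of the program.* Variables `0`, `1`: `n` and `k`; `2`, `3`: the lengths of the
forward Lyndon word (array `1`) and of the backward Lyndon word (array `0`); `4`: the length of the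
Lyndon root of `v`; `6`: the initial state `q` of the backward automaton; `7`: the length `t` of the
walks; `8`, `9`, `10`: current states and current letter; `15`: `n * n`; `16`, `17`: sums over the
rotations. Arrays `3`, `4`: current tables for `walks` and `walksNoReturn`; `5`, `6`: the next ones;
`2`: copy of `v`; `7`: numbers of closed words by length; `8`: table for the division. The other
variables are auxiliary.
-/

namespace EnclosingCount

/-! ### Lyndon words and their automaton -/

/-- The word `x 0, …, x (p - 1)` is a Lyndon word: it is nonempty, and each of its proper suffixes
is larger than the prefix of the same length, with a difference inside the suffix. Only the first
`p` values of `x` matter. -/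
def IsLyndon (x : ℕ → ℕ) (p : ℕ) : Prop :=
  0 < p ∧ ∀ q, 0 < q → q < p → ∃ j, q + j < p ∧ (∀ i < j, x (q + i) = x i) ∧ x j < x (q + j)

/-- The successor of state `q` under a letter `b` with `x q ≤ b`: state `q < p` stands for a
current match of length `q`, modulo `p`, with the periodic word `x^∞`. A larger letter ends the
match. -/
def next (x : ℕ → ℕ) (p q b : ℕ) : ℕ :=
  if x q < b then 0 else if q + 1 < p then q + 1 else 0

/-- The run of the automaton of `x^∞` on a finite word. It is rejected as soon as a letter is
smaller than the letter to be matched. -/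
def run (x : ℕ → ℕ) (p : ℕ) : ℕ → List ℕ → Option ℕ
  | q, [] => some q
  | q, b :: l => if b < x q then none else run x p (next x p q b) l

/-- Every suffix of the infinite word `z` is lexicographically at least `x^∞`. -/
def SuffixesGe (x : ℕ → ℕ) (p : ℕ) (z : ℕ → ℕ) : Prop :=
  ∀ i j, (∀ l < j, z (i + l) = x (l % p)) → x (j % p) ≤ z (i + j)

/-- Every factor of length `n` of the infinite word `z` is lexicographically at least
`v 0, …, v (n - 1)`. -/
def FactorsGe (v : ℕ → ℕ) (n : ℕ) (z : ℕ → ℕ) : Prop :=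
  ∀ i j, j < n → (∀ l < j, z (i + l) = v l) → v j ≤ z (i + j)

/-- The first `m` letters of `v` are a prefix of the periodic word with period `v 0, …, v (p - 1)`,
which is a Lyndon word. -/
def IsLyndonPrefix (v : ℕ → ℕ) (p m : ℕ) : Prop :=
  IsLyndon v p ∧ p ≤ m ∧ ∀ i, p ≤ i → i < m → v i = v (i - p)

/-- The Lyndon word `v 0, …, v (p - 1)` is the Lyndon root of `v 0, …, v (n - 1)`: this word is a
prefix of the periodic word with period `v 0, …, v (p - 1)`, or its first letter that differs
from that word is smaller. -/
def IsLyndonRoot (v : ℕ → ℕ) (n p : ℕ) : Prop :=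
  ∃ m, m ≤ n ∧ IsLyndonPrefix v p m ∧ (m = n ∨ v m < v (m - p))

theorem IsLyndonPrefix.eq_mod {v : ℕ → ℕ} {p m : ℕ} (h : IsLyndonPrefix v p m) :
    ∀ i, i < m → v i = v (i % p) := by
  intro i
  induction i using Nat.strong_induction_on with
  | _ i ih =>
    intro hi
    have hp := h.1.1
    rcases lt_or_ge i p with hip | hip
    · rw [Nat.mod_eq_of_lt hip]
    · rw [h.2.2 i hip hi, ih (i - p) (by omega) (by omega), Nat.mod_eq_sub_mod hip]

theorem isLyndonPrefix_one (v : ℕ → ℕ) : IsLyndonPrefix v 1 1 :=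
  ⟨⟨one_pos, fun q h h' => by omega⟩, le_rfl, fun i h h' => by omega⟩

theorem IsLyndonPrefix.succ {v : ℕ → ℕ} {p m : ℕ} (h : IsLyndonPrefix v p m)
    (hm : v m = v (m - p)) : IsLyndonPrefix v p (m + 1) := by
  refine ⟨h.1, by have := h.2.1; omega, fun i hi him => ?_⟩
  rcases Nat.lt_succ_iff_lt_or_eq.mp him with h' | rfl
  · exact h.2.2 i hi h'
  · exact hm

/-- The step of Duval's algorithm in which the period grows. -/
theorem IsLyndonPrefix.succ_of_lt {v : ℕ → ℕ} {p m : ℕ} (h : IsLyndonPrefix v p m)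
    (hm : v (m - p) < v m) : IsLyndonPrefix v (m + 1) (m + 1) := by
  refine ⟨⟨by omega, fun q hq hqm => ?_⟩, le_rfl, fun i hi him => by omega⟩
  have hp := h.1.1
  have hpm := h.2.1
  have hmod := h.eq_mod
  have hlast : v (m - p) = v (m % p) := by
    rw [hmod (m - p) (by omega), Nat.mod_eq_sub_mod hpm]
  rcases Nat.eq_zero_or_pos (q % p) with hr | hr
  · refine ⟨m - q, by omega, fun i hi => ?_, ?_⟩
    · rw [hmod (q + i) (by omega), hmod i (by omega), Nat.add_mod, hr, zero_add, Nat.mod_mod]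
    · have : (m - q) % p = m % p := by
        conv_rhs => rw [show m = q + (m - q) by omega, Nat.add_mod, hr, zero_add, Nat.mod_mod]
      rw [hmod (m - q) (by omega), this, ← hlast]
      rwa [show q + (m - q) = m by omega]
  · obtain ⟨j, hj, heq, hlt⟩ := h.1.2 (q % p) hr (Nat.mod_lt _ hp)
    have hidx : ∀ i ≤ j, (q + i) % p = q % p + i := by
      intro i hi
      rw [Nat.add_mod, Nat.mod_eq_of_lt (a := i) (by omega), Nat.mod_eq_of_lt (by omega)]
    have hle : ∀ i ≤ j, v i ≤ v (q % p + i) := by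
      intro i hi
      rcases hi.lt_or_eq with h' | rfl
      · exact (heq i h').ge
      · exact hlt.le
    rcases lt_or_ge (q + j) m with hqj | hqj
    · refine ⟨j, by omega, fun i hi => ?_, ?_⟩
      · rw [hmod (q + i) (by omega), hidx i hi.le, heq i hi]
      · rwa [hmod (q + j) hqj, hidx j le_rfl]
    · refine ⟨m - q, by omega, fun i hi => ?_, ?_⟩
      · rw [hmod (q + i) (by omega), hidx i (by omega), heq i (by omega)]
      · have h1 := hle (m - q) (by omega)
        rw [← hidx (m - q) (by omega), show q + (m - q) = m by omega, ← hlast] at h1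
        rw [show q + (m - q) = m by omega]
        omega

/-- All factors of length `n` are at least `v` exactly when all suffixes are at least the
periodic word of the Lyndon root of `v`. -/
theorem IsLyndonRoot.factorsGe_iff {v : ℕ → ℕ} {n p : ℕ} (h : IsLyndonRoot v n p) (z : ℕ → ℕ) :
    FactorsGe v n z ↔ SuffixesGe v p z := by
  obtain ⟨m, hmn, hpre, hm⟩ := h
  have hp := hpre.1.1
  have hpm := hpre.2.1
  have hmod := hpre.eq_mod
  have hlast : v (m - p) = v (m % p) := by
    rw [hmod (m - p) (by omega), Nat.mod_eq_sub_mod hpm]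
  constructor
  · intro hf i j
    -- a violation beyond position `m` moves to the left by multiples of the period
    induction j using Nat.strong_induction_on generalizing i with
    | _ j ih =>
      intro hj
      rcases lt_or_ge j m with hjm | hjm
      · rw [← hmod j hjm]
        exact hf i j (by omega) fun l hl => by rw [hj l hl, hmod l (by omega)]
      · have := ih (j - p) (by omega) (i + p) fun l hl => by
          rw [show i + p + l = i + (l + p) by omega, hj (l + p) (by omega), Nat.add_mod_right]
        rwa [show i + p + (j - p) = i + j by omega, ← Nat.mod_eq_sub_mod (by omega)] at this
  · intro hs i j hjn hj
    rcases lt_or_ge j m with hjm | hjm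
    · rw [hmod j hjm]
      exact hs i j fun l hl => by rw [hj l hl, hmod l (by omega)]
    · have h1 := hs i m fun l hl => by rw [hj l (by omega), hmod l hl]
      rcases hm with rfl | hm
      · omega
      · rcases hjm.lt_or_eq with h2 | rfl
        · rw [hj m h2, ← hlast] at h1
          omega
        · omega

theorem next_lt {x : ℕ → ℕ} {p : ℕ} (hp : 0 < p) (q b : ℕ) : next x p q b < p := by
  unfold next; split_ifs <;> omega

/-- `r` is the length of a border of the prefix of length `s` of `x`. -/
def IsBorder (x : ℕ → ℕ) (p r s : ℕ) : Prop :=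
  r ≤ s ∧ s < p ∧ ∀ l < r, x (s - r + l) = x l

/-- The automaton is monotone: two runs on the same word whose states are a prefix and a border of
it stay in this relation, and the run from the border is never rejected before the other. -/
theorem IsLyndon.isBorder_next {x : ℕ → ℕ} {p r s b : ℕ} (hx : IsLyndon x p)
    (h : IsBorder x p r s) (hb : x s ≤ b) :
    x r ≤ b ∧ IsBorder x p (next x p r b) (next x p s b) := by
  obtain ⟨hrs, hsp, hbd⟩ := h
  have hle : x r ≤ x s := by
    rcases hrs.lt_or_eq with hlt | rfl
    · obtain ⟨j, hj, heq, hlt'⟩ := hx.2 (s - r) (by omega) (by omega)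
      rcases lt_trichotomy j r with h1 | rfl | h1
      · have := hbd j h1; omega
      · rw [show s - j + j = s by omega] at hlt'; omega
      · have := heq r h1
        rw [show s - r + r = s by omega] at this; omega
    · exact le_rfl
  refine ⟨hle.trans hb, ?_⟩
  rcases hb.lt_or_eq with hlt | rfl
  · have h1 : next x p s b = 0 := if_pos hlt
    have h2 : next x p r b = 0 := if_pos (by omega)
    rw [h1, h2]
    exact ⟨le_rfl, hx.1, by simp⟩
  · rcases hle.lt_or_eq with hlt | heq
    · have h2 : next x p r (x s) = 0 := if_pos hlt
      rw [h2]
      exact ⟨Nat.zero_le _, next_lt hx.1 _ _, by simp⟩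
    · rcases hrs.lt_or_eq with hlt | rfl
      · rcases Nat.lt_or_ge (s + 1) p with h1 | h1
        · have h2 : next x p r (x s) = r + 1 := by unfold next; split_ifs <;> omega
          have h3 : next x p s (x s) = s + 1 := by unfold next; split_ifs <;> omega
          rw [h2, h3]
          refine ⟨by omega, h1, fun l hl => ?_⟩
          rw [show s + 1 - (r + 1) = s - r by omega]
          rcases Nat.lt_succ_iff_lt_or_eq.mp hl with h4 | rfl
          · exact hbd l h4
          · rw [show s - l + l = s by omega, heq]
        · -- a Lyndon word has no border
          obtain ⟨j, hj, -, hlt'⟩ := hx.2 (s - r) (by omega) (by omega)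
          rcases Nat.lt_succ_iff_lt_or_eq.mp (show j < r + 1 by omega) with h4 | rfl
          · have := hbd j h4; omega
          · rw [show s - j + j = s by omega] at hlt'; omega
      · have := next_lt (x := x) hx.1 r (x r)
        exact ⟨le_rfl, this, by simp⟩

theorem isBorder_zero {x : ℕ → ℕ} {p s : ℕ} (hs : s < p) : IsBorder x p 0 s :=
  ⟨Nat.zero_le _, hs, by simp⟩

/-- `s` is an infinite run of the automaton of `x^∞` on `z` that is never rejected. -/
def IsRun (x : ℕ → ℕ) (p : ℕ) (z s : ℕ → ℕ) : Prop :=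
  ∀ t, s t < p ∧ x (s t) ≤ z t ∧ s (t + 1) = next x p (s t) (z t)

theorem IsRun.shift {x : ℕ → ℕ} {p : ℕ} {z s : ℕ → ℕ} (h : IsRun x p z s) (i : ℕ) :
    IsRun x p (fun t => z (i + t)) (fun t => s (i + t)) := fun t => h (i + t)

/-- The states visited from `q` on `z`, whether or not the run is rejected. -/
def states (x : ℕ → ℕ) (p q : ℕ) (z : ℕ → ℕ) : ℕ → ℕ
  | 0 => q
  | t + 1 => next x p (states x p q z t) (z t)

theorem states_lt {x : ℕ → ℕ} {p q : ℕ} {z : ℕ → ℕ} (hp : 0 < p) (hq : q < p) :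
    ∀ t, states x p q z t < p
  | 0 => hq
  | _ + 1 => next_lt hp _ _

theorem IsRun.isBorder {x : ℕ → ℕ} {p : ℕ} {z s : ℕ → ℕ} (hx : IsLyndon x p)
    (h : IsRun x p z s) {r : ℕ} (hr : IsBorder x p r (s 0)) :
    ∀ t, IsBorder x p (states x p r z t) (s t)
  | 0 => hr
  | t + 1 => by
    rw [(h t).2.2]
    exact (hx.isBorder_next (IsRun.isBorder hx h hr t) (h t).2.1).2

theorem IsRun.isRun_states {x : ℕ → ℕ} {p : ℕ} {z s : ℕ → ℕ} (hx : IsLyndon x p)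
    (h : IsRun x p z s) {r : ℕ} (hr : IsBorder x p r (s 0)) :
    IsRun x p z (states x p r z) := fun t =>
  ⟨by have := h.isBorder hx hr t; exact this.1.trans_lt this.2.1,
    (hx.isBorder_next (h.isBorder hx hr t) (h t).2.1).1, rfl⟩

theorem IsRun.eq_states {x : ℕ → ℕ} {p : ℕ} {z s : ℕ → ℕ} (h : IsRun x p z s) :
    ∀ t, s t = states x p (s 0) z t
  | 0 => rfl
  | t + 1 => by rw [(h t).2.2, h.eq_states t]; rfl

theorem IsRun.exists_zero {x : ℕ → ℕ} {p : ℕ} {z s : ℕ → ℕ} (h : IsRun x p z s) :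
    ∃ t, s t = 0 := by
  by_contra! hne
  have : ∀ t, s t = s 0 + t := by
    intro t
    induction t with
    | zero => rfl
    | succ t ih =>
      have h1 := hne (t + 1)
      rw [(h t).2.2] at h1 ⊢
      unfold next at h1 ⊢
      split_ifs at h1 ⊢ <;> omega
  have h1 := this p
  have h2 := (h p).1
  omega

/-- Two runs on the same word agree eventually: each of them visits state `0`, and from then on its
states are borders of those of the other run. -/
theorem IsRun.eventually_eq {x : ℕ → ℕ} {p : ℕ} {z s s' : ℕ → ℕ} (hx : IsLyndon x p)
    (h : IsRun x p z s) (h' : IsRun x p z s') : ∃ N, ∀ t ≥ N, s t = s' t := by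
  have key : ∀ s s' : ℕ → ℕ, IsRun x p z s → IsRun x p z s' → ∃ N, ∀ t ≥ N, s t ≤ s' t := by
    intro s s' h h'
    obtain ⟨N, hN⟩ := h.exists_zero
    refine ⟨N, fun t ht => ?_⟩
    have h1 := (h.shift N).eq_states (t - N)
    have h2 := (h'.shift N).isBorder hx (isBorder_zero ((h' (N + 0)).1)) (t - N)
    simp only [add_zero, hN] at h1 h2
    rw [show N + (t - N) = t by omega] at h1 h2
    rw [h1]
    exact h2.1
  obtain ⟨N, hN⟩ := key s s' h h'
  obtain ⟨N', hN'⟩ := key s' s h' h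
  exact ⟨max N N', fun t ht => le_antisymm (hN t (le_trans (le_max_left _ _) ht))
    (hN' t (le_trans (le_max_right _ _) ht))⟩

theorem IsRun.suffixesGe {x : ℕ → ℕ} {p : ℕ} {z s : ℕ → ℕ} (hx : IsLyndon x p)
    (h : IsRun x p z s) : SuffixesGe x p z := by
  intro i j hj
  have h1 := (h.shift i).isRun_states hx (isBorder_zero (h (i + 0)).1)
  have h2 : ∀ l ≤ j, states x p 0 (fun t => z (i + t)) l = l % p := by
    intro l
    induction l with
    | zero => intro _; simp [states]
    | succ l ih =>
      intro hl
      have hp := hx.1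
      have hlt := Nat.mod_lt l hp
      rw [states, ih (by omega)]
      simp only [hj l (by omega), next, lt_irrefl, if_false]
      rcases Nat.lt_or_ge (l % p + 1) p with h3 | h3
      · rw [if_pos h3, Nat.add_mod, Nat.mod_eq_of_lt (a := 1) (by omega), Nat.mod_eq_of_lt h3]
      · rw [if_neg (by omega)]
        have : l % p + 1 = p := by omega
        rw [← Nat.mod_add_mod, this, Nat.mod_self]
  have h3 := (h1 j).2.1
  rwa [h2 j le_rfl] at h3

theorem SuffixesGe.isRun {x : ℕ → ℕ} {p : ℕ} {z : ℕ → ℕ} (hx : IsLyndon x p)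
    (h : SuffixesGe x p z) : IsRun x p z (states x p 0 z) := by
  have hp := hx.1
  -- the current state counts the letters matched so far
  have key : ∀ t, states x p 0 z t ≤ t ∧
      ∀ l < states x p 0 z t, z (t - states x p 0 z t + l) = x l := by
    intro t
    induction t with
    | zero => simp [states]
    | succ t ih =>
      obtain ⟨ih1, ih2⟩ := ih
      rw [states]
      set q := states x p 0 z t with hq
      have hqp : q < p := states_lt hp hp t
      have hle : x q ≤ z t := by
        have := h (t - q) q fun l hl => by rw [ih2 l hl, Nat.mod_eq_of_lt (by omega)]
        rwa [Nat.mod_eq_of_lt hqp, show t - q + q = t by omega] at this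
      unfold next
      split_ifs with h1 h2
      · simp
      · refine ⟨by omega, fun l hl => ?_⟩
        rw [show t + 1 - (q + 1) = t - q by omega]
        rcases Nat.lt_succ_iff_lt_or_eq.mp hl with h4 | rfl
        · exact ih2 l h4
        · rw [show t - q + q = t by omega]; omega
      · simp
  intro t
  have hqp : states x p 0 z t < p := states_lt hp hp t
  refine ⟨hqp, ?_, rfl⟩
  have h1 := key t
  have := h (t - states x p 0 z t) (states x p 0 z t) fun l hl => by
    rw [h1.2 l hl, Nat.mod_eq_of_lt (by omega)]
  rwa [Nat.mod_eq_of_lt hqp,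
    show t - states x p 0 z t + states x p 0 z t = t by omega] at this

/-! ### Closed runs on periodic words -/

/-- The periodic word `u u u …`. -/
def periodic (u : List ℕ) (i : ℕ) : ℕ := u.getD (i % u.length) 0

theorem periodic_add_length (u : List ℕ) (i : ℕ) :
    periodic u (i + u.length) = periodic u i := by
  simp [periodic]

theorem periodic_rotate (u : List ℕ) (i j : ℕ) :
    periodic (u.rotate i) j = periodic u (i + j) := by
  rcases Nat.eq_zero_or_pos u.length with h | h
  · rw [List.length_eq_zero_iff.mp h]; simp [periodic]
  · have h1 : j % u.length < u.length := Nat.mod_lt _ h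
    have h2 : (i + j) % u.length < u.length := Nat.mod_lt _ h
    simp only [periodic, List.length_rotate]
    rw [List.getD_eq_getElem _ _ (by simpa using h1), List.getD_eq_getElem _ _ h2,
      List.getElem_rotate]
    congr 1
    rw [Nat.mod_add_mod, add_comm]

theorem run_append (x : ℕ → ℕ) (p q : ℕ) (u w : List ℕ) :
    run x p q (u ++ w) = (run x p q u).bind fun r => run x p r w := by
  induction u generalizing q with
  | nil => rfl
  | cons b u ih =>
    simp only [List.cons_append, run]
    split_ifs
    · rfl
    · exact ih _

theorem run_lt {x : ℕ → ℕ} {p : ℕ} (hp : 0 < p) {q r : ℕ} (hq : q < p) {u : List ℕ}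
    (h : run x p q u = some r) : r < p := by
  induction u generalizing q with
  | nil => simp only [run, Option.some.injEq] at h; omega
  | cons b u ih =>
    simp only [run] at h
    split_ifs at h
    exact ih (next_lt hp _ _) h

theorem run_eq_some_iff (x : ℕ → ℕ) (p q r : ℕ) (u : List ℕ) (z : ℕ → ℕ)
    (hz : ∀ i (h : i < u.length), u[i] = z i) :
    run x p q u = some r ↔
      (∀ t < u.length, x (states x p q z t) ≤ z t) ∧ states x p q z u.length = r := by
  induction u using List.reverseRecOn generalizing r with
  | nil => simp [run, states]
  | append_singleton u b ih =>
    have hb : b = z u.length := by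
      have := hz u.length (by simp)
      simpa using this
    have hz' : ∀ i (h : i < u.length), u[i] = z i := fun i h => by
      have := hz i (by simp; omega)
      rwa [List.getElem_append_left h] at this
    rw [run_append, Option.bind_eq_some_iff]
    simp only [ih _ hz', run, List.length_append, List.length_singleton]
    constructor
    · rintro ⟨s, ⟨h2, rfl⟩, h3⟩
      split_ifs at h3 with h4
      refine ⟨fun t ht => ?_, ?_⟩
      · rcases Nat.lt_succ_iff_lt_or_eq.mp ht with h5 | rfl
        · exact h2 t h5
        · omega
      · rw [states, ← hb]
        simpa using h3
    · rintro ⟨h2, h3⟩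
      refine ⟨_, ⟨fun t ht => h2 t (by omega), rfl⟩, ?_⟩
      have h4 := h2 u.length (by omega)
      rw [if_neg (by omega), hb]
      rw [← h3, states]

theorem getElem_eq_periodic (u : List ℕ) (i : ℕ) (h : i < u.length) : u[i] = periodic u i := by
  rw [periodic, Nat.mod_eq_of_lt h, List.getD_eq_getElem _ _ h]

theorem states_add (x : ℕ → ℕ) (p q : ℕ) (z : ℕ → ℕ) (i t : ℕ) :
    states x p q z (i + t) = states x p (states x p q z i) (fun l => z (i + l)) t := by
  induction t with
  | zero => rfl
  | succ t ih => rw [← add_assoc, states, ih]; rfl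

/-- A closed run on `u` extends to a periodic run on `u u u …`. -/
theorem isRun_of_run_eq {x : ℕ → ℕ} {p q : ℕ} (hp : 0 < p) (hq : q < p) {u : List ℕ}
    (hu : u ≠ []) (h : run x p q u = some q) :
    IsRun x p (periodic u) (states x p q (periodic u)) ∧
      ∀ t, states x p q (periodic u) (t + u.length) = states x p q (periodic u) t := by
  obtain ⟨h1, h2⟩ := (run_eq_some_iff x p q q u _ (getElem_eq_periodic u)).mp h
  have hper : ∀ t, states x p q (periodic u) (t + u.length) = states x p q (periodic u) t := by
    intro t
    rw [add_comm, states_add, h2]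
    congr 1
    funext l
    rw [add_comm, periodic_add_length]
  have hlen : 0 < u.length := List.length_pos_iff.mpr hu
  refine ⟨fun t => ⟨states_lt hp hq t, ?_, rfl⟩, hper⟩
  induction t using Nat.strong_induction_on with
  | _ t ih =>
    rcases lt_or_ge t u.length with ht | ht
    · exact h1 t ht
    · have := ih (t - u.length) (by omega)
      rw [← hper, ← periodic_add_length, show t - u.length + u.length = t by omega] at this
      exact this

/-- A function with period `d` is determined by its values far out. -/
theorem eq_of_eventually_eq {f g : ℕ → ℕ} {d : ℕ} (hd : 0 < d) (hf : ∀ t, f (t + d) = f t)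
    (hg : ∀ t, g (t + d) = g t) {N : ℕ} (h : ∀ t ≥ N, f t = g t) (t : ℕ) : f t = g t := by
  have key : ∀ (f : ℕ → ℕ), (∀ t, f (t + d) = f t) → ∀ m, f (t + m * d) = f t := by
    intro f hf m
    induction m with
    | zero => simp
    | succ m ih => rw [Nat.succ_mul, ← add_assoc, hf, ih]
  rw [← key f hf N, ← key g hg N]
  exact h _ (by nlinarith)

theorem closed_run_unique {x : ℕ → ℕ} {p : ℕ} (hx : IsLyndon x p) {u : List ℕ} (hu : u ≠ [])
    {q q' : ℕ} (hq : q < p) (hq' : q' < p) (h : run x p q u = some q)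
    (h' : run x p q' u = some q') : q = q' := by
  obtain ⟨h1, h2⟩ := isRun_of_run_eq hx.1 hq hu h
  obtain ⟨h1', h2'⟩ := isRun_of_run_eq hx.1 hq' hu h'
  obtain ⟨N, hN⟩ := h1.eventually_eq hx h1'
  exact eq_of_eventually_eq (List.length_pos_iff.mpr hu) h2 h2' hN 0

/-- The automaton has a closed run on `u`. -/
def Closed (x : ℕ → ℕ) (p : ℕ) (u : List ℕ) : Prop := ∃ q < p, run x p q u = some q

theorem closed_iff_suffixesGe {x : ℕ → ℕ} {p : ℕ} (hx : IsLyndon x p) {u : List ℕ}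
    (hu : u ≠ []) : Closed x p u ↔ SuffixesGe x p (periodic u) := by
  constructor
  · rintro ⟨q, hq, h⟩
    exact (isRun_of_run_eq hx.1 hq hu h).1.suffixesGe hx
  · intro h
    have h1 := h.isRun hx
    have h2 : IsRun x p (periodic u) (fun t => states x p 0 (periodic u) (u.length + t)) := by
      have := h1.shift u.length
      have heq : (fun t => periodic u (u.length + t)) = periodic u :=
        funext fun t => by rw [add_comm, periodic_add_length]
      rwa [heq] at this
    obtain ⟨N, hN⟩ := h1.eventually_eq hx h2
    -- after a multiple of the length that is large enough, the run has become periodic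
    have hlen : 0 < u.length := List.length_pos_iff.mpr hu
    have h3 : (fun l => periodic u (N * u.length + l)) = periodic u := by
      funext l
      simp [periodic]
    refine ⟨_, (h1 (N * u.length)).1, ?_⟩
    rw [run_eq_some_iff x p _ _ u _ (getElem_eq_periodic u)]
    have h4 : ∀ t, states x p (states x p 0 (periodic u) (N * u.length)) (periodic u) t =
        states x p 0 (periodic u) (N * u.length + t) := by
      intro t
      rw [states_add, h3]
    refine ⟨fun t _ => ?_, ?_⟩
    · have h5 := (h1 (N * u.length + t)).2.1
      rw [h4, ← congrFun h3 t]
      exact h5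
    · rw [h4, hN (N * u.length) (by nlinarith), add_comm]

theorem exists_rotate_run_zero {x : ℕ → ℕ} {p : ℕ} (hx : IsLyndon x p) {u : List ℕ} (hu : u ≠ [])
    (h : Closed x p u) : ∃ i < u.length, run x p 0 (u.rotate i) = some 0 := by
  obtain ⟨q, hq, h⟩ := h
  obtain ⟨h1, h2⟩ := isRun_of_run_eq hx.1 hq hu h
  obtain ⟨t, ht⟩ := h1.exists_zero
  have hlen : 0 < u.length := List.length_pos_iff.mpr hu
  refine ⟨t % u.length, Nat.mod_lt _ hlen, ?_⟩
  rw [List.rotate_mod, run_eq_some_iff x p _ _ (u.rotate t) _ (getElem_eq_periodic _)]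
  have h3 : periodic (u.rotate t) = fun j => periodic u (t + j) :=
    funext fun j => periodic_rotate u t j
  have h4 : ∀ j, states x p 0 (periodic (u.rotate t)) j = states x p q (periodic u) (t + j) := by
    intro j
    rw [states_add, ht, h3]
  refine ⟨fun j _ => ?_, ?_⟩
  · rw [h4, periodic_rotate]
    exact (h1 (t + j)).2.1
  · rw [h4, List.length_rotate, h2, ht]

theorem Closed.rotate {x : ℕ → ℕ} {p : ℕ} (hx : IsLyndon x p) {u : List ℕ} (i : ℕ)
    (h : Closed x p u) : Closed x p (u.rotate i) := by
  rcases eq_or_ne u [] with rfl | hu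
  · simpa using h
  · rw [closed_iff_suffixesGe hx (by simpa using hu)]
    have h1 := (closed_iff_suffixesGe hx hu).mp h
    intro a j hj
    have := h1 (i + a) j fun l hl => by
      rw [add_assoc, ← periodic_rotate, hj l hl]
    rwa [add_assoc, ← periodic_rotate] at this

/-! ### Counting words by a recurrence over pairs of states -/

/-- The words of length `n` with letters smaller than `k`. -/
def words (k : ℕ) : ℕ → Finset (List ℕ)
  | 0 => {[]}
  | n + 1 => (words k n ×ˢ Finset.range k).image fun c => c.1 ++ [c.2]

theorem mem_words {k n : ℕ} {u : List ℕ} :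
    u ∈ words k n ↔ u.length = n ∧ ∀ a ∈ u, a < k := by
  induction n generalizing u with
  | zero =>
    simp only [words, Finset.mem_singleton, List.length_eq_zero_iff]
    exact ⟨by rintro rfl; simp, fun h => h.1⟩
  | succ n ih =>
    simp only [words, Finset.mem_image, Finset.mem_product, ih, Finset.mem_range, Prod.exists]
    constructor
    · rintro ⟨w, b, ⟨⟨h1, h2⟩, h3⟩, rfl⟩
      refine ⟨by simp [h1], fun a ha => ?_⟩
      rcases List.mem_append.mp ha with h | h
      · exact h2 a h
      · rw [List.mem_singleton.mp h]; exact h3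
    · rintro ⟨h1, h2⟩
      have hne : u ≠ [] := by rintro rfl; simp at h1
      exact ⟨u.dropLast, u.getLast hne, ⟨⟨by simp [h1],
        fun a ha => h2 a (List.mem_of_mem_dropLast ha)⟩, h2 _ (List.getLast_mem hne)⟩,
        List.dropLast_append_getLast hne⟩

theorem sum_words_succ {M : Type*} [AddCommMonoid M] (k n : ℕ) (f : List ℕ → M) :
    ∑ u ∈ words k (n + 1), f u = ∑ u ∈ words k n, ∑ b ∈ Finset.range k, f (u ++ [b]) := by
  rw [words, Finset.sum_image, Finset.sum_product]
  rintro ⟨u, b⟩ - ⟨u', b'⟩ - h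
  have := List.append_inj' h rfl
  simp_all

theorem card_words_le (k n : ℕ) : (words k n).card ≤ k ^ n := by
  induction n with
  | zero => simp [words]
  | succ n ih =>
    refine Finset.card_image_le.trans ?_
    rw [Finset.card_product, Finset.card_range, pow_succ]
    exact Nat.mul_le_mul_right _ ih

/-- The run from state `0` on `u` does not visit state `0` at the times `1, …, j`. -/
def NoReturn (x : ℕ → ℕ) (p : ℕ) (u : List ℕ) (j : ℕ) : Prop :=
  ∀ i ∈ Finset.Icc 1 j, run x p 0 (u.take i) ≠ some 0

instance (x : ℕ → ℕ) (p : ℕ) (u : List ℕ) (j : ℕ) : Decidable (NoReturn x p u j) := by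
  unfold NoReturn; infer_instance

/-- The first time at which the run from state `0` on `u` returns to `0`, or the length of `u` plus
one if there is none. -/
def returnTime (x : ℕ → ℕ) (p : ℕ) (u : List ℕ) : ℕ :=
  ((Finset.range (u.length + 1)).filter fun j => NoReturn x p u j).card

/-- The total weight of the words `u` of length `t` that are read forwards from state `0` to state
`r` by the automaton of `x^∞` and backwards from state `q` to state `q₀` by that of `y^∞`. -/
def weightSum (x : ℕ → ℕ) (px : ℕ) (y : ℕ → ℕ) (py k q₀ : ℕ) (w : List ℕ → ℕ) (t r q : ℕ) : ℕ :=
  ∑ u ∈ words k t,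
    if run x px 0 u = some r ∧ run y py q u.reverse = some q₀ then w u else 0

theorem run_append_singleton_eq_some {x : ℕ → ℕ} {p q b r : ℕ} {u : List ℕ} :
    run x p q (u ++ [b]) = some r ↔
      ∃ s, run x p q u = some s ∧ x s ≤ b ∧ next x p s b = r := by
  rw [run_append, Option.bind_eq_some_iff]
  refine exists_congr fun s => and_congr_right fun _ => ?_
  simp only [run]
  split_ifs with h
  · simp; omega
  · simp; omega

theorem run_cons_eq_some {x : ℕ → ℕ} {p q b r : ℕ} {u : List ℕ} :
    run x p q (b :: u) = some r ↔ x q ≤ b ∧ run x p (next x p q b) u = some r := by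
  simp only [run]
  split_ifs with h
  · simp; omega
  · simp; omega

/-- Appending a letter is the last step of the forward run and the first one of the backward
run. -/
theorem weightSum_succ {x : ℕ → ℕ} {px : ℕ} (hpx : 0 < px) (y : ℕ → ℕ) (py k q₀ : ℕ)
    (w : List ℕ → ℕ) (t r q : ℕ) :
    weightSum x px y py k q₀ w (t + 1) r q =
      ∑ s ∈ Finset.range px, ∑ b ∈ Finset.range k,
        if x s ≤ b ∧ y q ≤ b ∧ next x px s b = r then
          weightSum x px y py k q₀ (fun u => w (u ++ [b])) t s (next y py q b) else 0 := by
  rw [weightSum, sum_words_succ]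
  have h1 : ∀ s b, (if x s ≤ b ∧ y q ≤ b ∧ next x px s b = r then
      weightSum x px y py k q₀ (fun u => w (u ++ [b])) t s (next y py q b) else 0) =
      ∑ u ∈ words k t, if (x s ≤ b ∧ y q ≤ b ∧ next x px s b = r) ∧
        run x px 0 u = some s ∧ run y py (next y py q b) u.reverse = some q₀
        then w (u ++ [b]) else 0 := by
    intro s b
    split_ifs with h
    · simp only [weightSum, h, true_and, and_true]
    · simp [h]
  simp only [h1]
  rw [Finset.sum_comm, Finset.sum_comm (s := Finset.range px)]
  refine Finset.sum_congr rfl fun b _ => ?_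
  rw [Finset.sum_comm]
  refine Finset.sum_congr rfl fun u _ => ?_
  simp only [List.reverse_append, List.reverse_singleton, List.singleton_append,
    run_append_singleton_eq_some, run_cons_eq_some]
  rcases hu : run x px 0 u with _ | s
  · simp
  · have hs := run_lt hpx hpx hu
    rw [Finset.sum_eq_single_of_mem s (Finset.mem_range.mpr hs)]
    · congr 1
      simp only [Option.some.injEq, exists_eq_left', true_and, eq_iff_iff]
      tauto
    · intro s' _ hne
      rw [if_neg]
      rintro ⟨-, h, -⟩
      exact hne (Option.some.inj h).symm

/-- The number of words of `weightSum` whose forward run does not return to state `0`. -/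
def walksNoReturn (x : ℕ → ℕ) (px : ℕ) (y : ℕ → ℕ) (py k q₀ : ℕ) : ℕ → ℕ → ℕ → ℕ :=
  weightSum x px y py k q₀ fun u => if NoReturn x px u u.length then 1 else 0

/-- The words of `weightSum`, counted with the time of the first return of the forward run. -/
def walks (x : ℕ → ℕ) (px : ℕ) (y : ℕ → ℕ) (py k q₀ : ℕ) : ℕ → ℕ → ℕ → ℕ :=
  weightSum x px y py k q₀ (returnTime x px)

theorem noReturn_append_singleton {x : ℕ → ℕ} {p b : ℕ} {u : List ℕ} {j : ℕ}
    (hj : j ≤ u.length) : NoReturn x p (u ++ [b]) j ↔ NoReturn x p u j := by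
  unfold NoReturn
  refine forall₂_congr fun i hi => ?_
  rw [List.take_append_of_le_length]
  have := Finset.mem_Icc.mp hi
  omega

theorem noReturn_append_singleton_length {x : ℕ → ℕ} {p b : ℕ} {u : List ℕ} :
    NoReturn x p (u ++ [b]) (u.length + 1) ↔
      NoReturn x p u u.length ∧ run x p 0 (u ++ [b]) ≠ some 0 := by
  rw [← noReturn_append_singleton (b := b) le_rfl]
  unfold NoReturn
  constructor
  · refine fun h => ⟨fun i hi => h i ?_, ?_⟩
    · simp only [Finset.mem_Icc] at hi ⊢; omega
    · have := h (u.length + 1) (by simp)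
      rwa [List.take_of_length_le (by simp)] at this
  · rintro ⟨h1, h2⟩ i hi
    rcases Nat.lt_or_ge i (u.length + 1) with h | h
    · exact h1 i (by simp only [Finset.mem_Icc] at hi ⊢; omega)
    · rwa [List.take_of_length_le (by simpa using h)]

theorem returnTime_append_singleton (x : ℕ → ℕ) (p b : ℕ) (u : List ℕ) :
    returnTime x p (u ++ [b]) =
      returnTime x p u + if NoReturn x p (u ++ [b]) (u.length + 1) then 1 else 0 := by
  unfold returnTime
  rw [List.length_append, List.length_singleton, Finset.range_add_one (n := u.length + 1),
    Finset.filter_insert]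
  have h : (Finset.range (u.length + 1)).filter (fun j => NoReturn x p (u ++ [b]) j) =
      (Finset.range (u.length + 1)).filter fun j => NoReturn x p u j :=
    Finset.filter_congr fun j hj =>
      noReturn_append_singleton (by have := Finset.mem_range.mp hj; omega)
  rw [h]
  split_ifs with h1
  · rw [Finset.card_insert_of_notMem (by simp)]
  · rfl

theorem walksNoReturn_zero (x : ℕ → ℕ) (px : ℕ) (y : ℕ → ℕ) (py k q₀ r q : ℕ) :
    walksNoReturn x px y py k q₀ 0 r q = if r = 0 ∧ q = q₀ then 1 else 0 := by
  have h : NoReturn x px [] 0 := by simp [NoReturn]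
  simp [walksNoReturn, weightSum, words, run, h, eq_comm (a := 0), eq_comm (a := q)]

theorem walks_zero (x : ℕ → ℕ) (px : ℕ) (y : ℕ → ℕ) (py k q₀ r q : ℕ) :
    walks x px y py k q₀ 0 r q = if r = 0 ∧ q = q₀ then 1 else 0 := by
  have h : NoReturn x px [] 0 := by simp [NoReturn]
  simp [walks, weightSum, words, run, returnTime, h, Finset.filter_singleton, eq_comm (a := 0)]

theorem weightSum_add (x : ℕ → ℕ) (px : ℕ) (y : ℕ → ℕ) (py k q₀ : ℕ)
    (w w' : List ℕ → ℕ) (t r q : ℕ) :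
    weightSum x px y py k q₀ (fun u => w u + w' u) t r q =
      weightSum x px y py k q₀ w t r q + weightSum x px y py k q₀ w' t r q := by
  unfold weightSum
  rw [← Finset.sum_add_distrib]
  exact Finset.sum_congr rfl fun u _ => by split_ifs <;> simp

theorem weightSum_congr {x : ℕ → ℕ} {px : ℕ} {y : ℕ → ℕ} {py k q₀ : ℕ}
    {w w' : List ℕ → ℕ} {t r q : ℕ} (h : ∀ u, run x px 0 u = some r → w u = w' u) :
    weightSum x px y py k q₀ w t r q = weightSum x px y py k q₀ w' t r q := by
  unfold weightSum
  refine Finset.sum_congr rfl fun u _ => ?_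
  split_ifs with h1
  · exact h u h1.1
  · rfl

theorem weightSum_noReturn_append {x : ℕ → ℕ} {px : ℕ} {y : ℕ → ℕ} {py k q₀ t s q b : ℕ}
    (hb : x s ≤ b) :
    weightSum x px y py k q₀
        (fun u => if NoReturn x px (u ++ [b]) (u.length + 1) then 1 else 0) t s q =
      if next x px s b ≠ 0 then walksNoReturn x px y py k q₀ t s q else 0 := by
  have h1 : ∀ u, run x px 0 u = some s →
      (if NoReturn x px (u ++ [b]) (u.length + 1) then 1 else 0) =
      if next x px s b ≠ 0 then (if NoReturn x px u u.length then 1 else 0) else 0 := by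
    intro u hu
    have : run x px 0 (u ++ [b]) = some (next x px s b) :=
      run_append_singleton_eq_some.mpr ⟨s, hu, hb, rfl⟩
    simp only [noReturn_append_singleton_length, this, ne_eq, Option.some.injEq]
    split_ifs <;> simp_all
  rw [weightSum_congr h1]
  split_ifs with h2
  · rfl
  · simp [weightSum]

theorem walksNoReturn_succ {x : ℕ → ℕ} {px : ℕ} (hpx : 0 < px) (y : ℕ → ℕ) (py k q₀ t r q : ℕ) :
    walksNoReturn x px y py k q₀ (t + 1) r q =
      ∑ s ∈ Finset.range px, ∑ b ∈ Finset.range k,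
        if x s ≤ b ∧ y q ≤ b ∧ next x px s b = r then
          (if next x px s b ≠ 0 then walksNoReturn x px y py k q₀ t s (next y py q b) else 0)
        else 0 := by
  rw [walksNoReturn, weightSum_succ hpx]
  refine Finset.sum_congr rfl fun s _ => Finset.sum_congr rfl fun b _ => ?_
  split_ifs with h1 h2
  all_goals try rfl
  all_goals
    simp only [List.length_append, List.length_singleton]
    rw [weightSum_noReturn_append h1.1]
    simp [h2, walksNoReturn]

theorem walks_succ {x : ℕ → ℕ} {px : ℕ} (hpx : 0 < px) (y : ℕ → ℕ) (py k q₀ t r q : ℕ) :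
    walks x px y py k q₀ (t + 1) r q =
      ∑ s ∈ Finset.range px, ∑ b ∈ Finset.range k,
        if x s ≤ b ∧ y q ≤ b ∧ next x px s b = r then
          walks x px y py k q₀ t s (next y py q b) +
          (if next x px s b ≠ 0 then walksNoReturn x px y py k q₀ t s (next y py q b) else 0)
        else 0 := by
  rw [walks, weightSum_succ hpx]
  refine Finset.sum_congr rfl fun s _ => Finset.sum_congr rfl fun b _ => ?_
  split_ifs with h1
  all_goals try rfl
  all_goals
    simp only [returnTime_append_singleton]
    rw [weightSum_add, weightSum_noReturn_append h1.1]
    simp_all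

/-- The words of length `d` on which both automata, one of them reading backwards, have closed
runs. -/
noncomputable def closedWords (x : ℕ → ℕ) (px : ℕ) (y : ℕ → ℕ) (py k d : ℕ) : Finset (List ℕ) :=
  open Classical in (words k d).filter fun u => Closed x px u ∧ Closed y py u.reverse

theorem mem_closedWords {x : ℕ → ℕ} {px : ℕ} {y : ℕ → ℕ} {py k d : ℕ} {u : List ℕ} :
    u ∈ closedWords x px y py k d ↔ u ∈ words k d ∧ Closed x px u ∧ Closed y py u.reverse := by
  simp [closedWords]

theorem rotate_mem_words {k d : ℕ} {u : List ℕ} (i : ℕ) (h : u ∈ words k d) :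
    u.rotate i ∈ words k d := by
  rw [mem_words] at h ⊢
  simpa using h

theorem Closed.reverse_rotate {y : ℕ → ℕ} {py : ℕ} (hy : IsLyndon y py) {u : List ℕ} (i : ℕ)
    (h : Closed y py u.reverse) : Closed y py (u.rotate i).reverse := by
  rw [List.reverse_rotate]
  exact h.rotate hy _

/-- On a closed word, a prefix leads from `0` to `0` exactly when the corresponding rotation is
read from `0` to `0`. -/
theorem run_take_eq_zero_iff {x : ℕ → ℕ} {p : ℕ} (hx : IsLyndon x p) {u : List ℕ} {i : ℕ}
    (hu : run x p 0 u = some 0) (hi : i ≤ u.length) :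
    run x p 0 (u.take i) = some 0 ↔ run x p 0 (u.rotate i) = some 0 := by
  rcases eq_or_ne u [] with rfl | hne
  · simp
  rw [List.rotate_eq_drop_append_take hi]
  have hsplit : run x p 0 (u.take i ++ u.drop i) = some 0 := by rwa [List.take_append_drop]
  rw [run_append, Option.bind_eq_some_iff] at hsplit
  obtain ⟨r, h1, h2⟩ := hsplit
  constructor
  · intro h
    rw [h1] at h
    obtain rfl := Option.some.inj h
    rw [run_append, h2]
    exact h1
  · intro h
    have h3 : run x p r (u.drop i ++ u.take i) = some r := by
      rw [run_append, h2]; exact h1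
    have hne' : u.drop i ++ u.take i ≠ [] := by
      rw [← List.rotate_eq_drop_append_take hi]; simpa using hne
    rw [h1, closed_run_unique hx hne' (run_lt hx.1 hx.1 h1) hx.1 h3 h]

open Classical in
theorem returnTime_eq {x : ℕ → ℕ} {p : ℕ} (hx : IsLyndon x p) {u : List ℕ} (hne : u ≠ [])
    (hu : run x p 0 u = some 0) :
    returnTime x p u = ((Finset.range u.length).filter fun j =>
      ∀ i, 1 ≤ i → i ≤ j → run x p 0 (u.rotate i) ≠ some 0).card := by
  unfold returnTime
  refine congrArg Finset.card (Finset.ext fun j => ?_)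
  simp only [Finset.mem_filter, Finset.mem_range, NoReturn, Finset.mem_Icc]
  have hlen := List.length_pos_iff.mpr hne
  constructor
  · rintro ⟨h1, h2⟩
    have hj : j < u.length := by
      by_contra hj
      refine h2 u.length ⟨hlen, by omega⟩ ?_
      rwa [List.take_length]
    exact ⟨hj, fun i hi hij => by
      rw [Ne, ← run_take_eq_zero_iff hx hu (by omega)]; exact h2 i ⟨hi, hij⟩⟩
  · rintro ⟨h1, h2⟩
    exact ⟨by omega, fun i hi => by
      rw [Ne, run_take_eq_zero_iff hx hu (by omega)]; exact h2 i hi.1 hi.2⟩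

theorem sum_ite_exists_unique {N m : ℕ} {P : ℕ → Prop} [DecidablePred P]
    [Decidable (∃ q < N, P q)] (h : ∀ q < N, ∀ q' < N, P q → P q' → q = q') :
    (∑ q ∈ Finset.range N, if P q then m else 0) = if ∃ q < N, P q then m else 0 := by
  split_ifs with h1
  · obtain ⟨q, hq, hP⟩ := h1
    rw [Finset.sum_eq_single_of_mem q (Finset.mem_range.mpr hq), if_pos hP]
    intro q' hq' hne
    rw [if_neg fun hP' => hne (h q' (Finset.mem_range.mp hq') q hq hP' hP)]
  · push Not at h1
    exact Finset.sum_eq_zero fun q hq => if_neg (h1 q (Finset.mem_range.mp hq))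

/-- Every closed word arises from exactly one word `u` read from `0` to `0`, by a rotation by less
than the first return time of `u`. Hence the words read from `0` to `0`, weighted with their
first return times, count all closed words. -/
theorem sum_walks_eq_card {x : ℕ → ℕ} {px : ℕ} (hx : IsLyndon x px) {y : ℕ → ℕ} {py : ℕ}
    (hy : IsLyndon y py) (k : ℕ) {d : ℕ} (hd : 0 < d) :
    ∑ q ∈ Finset.range py, walks x px y py k q d 0 q = (closedWords x px y py k d).card := by
  classical
  have hne : ∀ u ∈ words k d, u ≠ [] := by
    rintro u hu rfl
    have := (mem_words.mp hu).1
    simp at this; omega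
  have h1 : ∑ q ∈ Finset.range py, walks x px y py k q d 0 q =
      ∑ u ∈ (words k d).filter (fun u => run x px 0 u = some 0 ∧ Closed y py u.reverse),
        ((Finset.range d).filter fun j =>
          ∀ i, 1 ≤ i → i ≤ j → run x px 0 (u.rotate i) ≠ some 0).card := by
    simp only [walks, weightSum]
    rw [Finset.sum_comm, Finset.sum_filter]
    refine Finset.sum_congr rfl fun u hu => ?_
    by_cases hz : run x px 0 u = some 0
    · have hu' := hne u hu
      simp only [hz, true_and]
      rw [returnTime_eq hx hu' hz, sum_ite_exists_unique, (mem_words.mp hu).1]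
      · exact if_congr Iff.rfl rfl rfl
      · intro q hq q' hq' h h'
        exact closed_run_unique hy (by simpa using hu') hq hq' h h'
    · simp [hz]
  rw [h1, ← Finset.card_sigma]
  refine Finset.card_bij (fun c _ => c.1.rotate c.2) ?_ ?_ ?_
  · rintro ⟨u, j⟩ h
    simp only [Finset.mem_sigma, Finset.mem_filter] at h
    obtain ⟨⟨hu, hz, hc⟩, -⟩ := h
    exact mem_closedWords.mpr ⟨rotate_mem_words _ hu, Closed.rotate hx _ ⟨0, hx.1, hz⟩,
      hc.reverse_rotate hy _⟩
  · have key : ∀ u ∈ words k d, ∀ u' ∈ words k d, ∀ j j', j < j' →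
        run x px 0 u = some 0 →
        (∀ i, 1 ≤ i → i ≤ j' → run x px 0 (u'.rotate i) ≠ some 0) →
        u.rotate j ≠ u'.rotate j' := by
      intro u hu u' hu' j j' hjj hz hno heq
      rw [show j' = (j' - j) + j by omega, ← List.rotate_rotate] at heq
      have := List.rotate_injective j heq
      exact hno (j' - j) (by omega) (by omega) (this ▸ hz)
    rintro ⟨u, j⟩ h ⟨u', j'⟩ h' heq
    simp only [Finset.mem_sigma, Finset.mem_filter] at h h'
    dsimp only at heq
    rcases lt_trichotomy j j' with hlt | rfl | hlt
    · exact absurd heq (key u h.1.1 u' h'.1.1 j j' hlt h.1.2.1 h'.2.2)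
    · rw [List.rotate_injective j heq]
    · exact absurd heq.symm (key u' h'.1.1 u h.1.1 j' j hlt h'.1.2.1 h.2.2)
  · intro u hu
    obtain ⟨hu, hcx, hcy⟩ := mem_closedWords.mp hu
    have hlen := (mem_words.mp hu).1
    obtain ⟨a, ha, hz⟩ := exists_rotate_run_zero hx (hne u hu) hcx
    -- the last visit of state `0` at a time in `1, …, d`
    obtain ⟨i, hi1, hid, hzi, hmax⟩ : ∃ i, 1 ≤ i ∧ i ≤ d ∧ run x px 0 (u.rotate i) = some 0 ∧
        ∀ i', i < i' → i' ≤ d → run x px 0 (u.rotate i') ≠ some 0 := by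
      let P : ℕ → Prop := fun i => 1 ≤ i ∧ run x px 0 (u.rotate i) = some 0
      obtain ⟨i₀, hi₀, hP⟩ : ∃ i ≤ d, P i := by
        rcases Nat.eq_zero_or_pos a with rfl | hpos
        · refine ⟨d, le_rfl, hd, ?_⟩
          rw [← hlen, List.rotate_length]
          simpa using hz
        · exact ⟨a, by omega, hpos, hz⟩
      have h2 := Nat.findGreatest_spec (P := P) hi₀ hP
      refine ⟨Nat.findGreatest P d, h2.1, Nat.findGreatest_le d, h2.2, fun i' hi' hi'd h => ?_⟩
      exact Nat.findGreatest_is_greatest hi' hi'd ⟨by omega, h⟩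
    refine ⟨⟨u.rotate i, d - i⟩, ?_, ?_⟩
    · simp only [Finset.mem_sigma, Finset.mem_filter, Finset.mem_range]
      refine ⟨⟨rotate_mem_words _ hu, hzi, hcy.reverse_rotate hy _⟩, by omega, fun l hl hl' => ?_⟩
      rw [List.rotate_rotate]
      exact hmax _ (by omega) (by omega)
    · dsimp only
      rw [List.rotate_rotate, show i + (d - i) = d by omega, ← hlen, List.rotate_length]

open Bracelets RAM

/-! ### Necklaces and rotations -/

/-- The rotation action of `ZMod n` on a set of words of length `n` that is closed under
rotation. -/
abbrev rotationAction {A : Type*} {n : ℕ} [NeZero n] (S : Set (List A))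
    (hlen : ∀ w ∈ S, w.length = n) (hrot : ∀ w ∈ S, ∀ i, w.rotate i ∈ S) :
    AddAction (ZMod n) S where
  vadd a w := ⟨w.1.rotate a.val, hrot _ w.2 _⟩
  zero_vadd w := Subtype.ext (by change w.1.rotate (0 : ZMod n).val = w.1; simp)
  add_vadd a b w := Subtype.ext (by
    change w.1.rotate (a + b).val = (w.1.rotate b.val).rotate a.val
    rw [List.rotate_rotate, ZMod.val_add, ← List.rotate_mod _ (b.val + a.val), hlen _ w.2,
      add_comm])

theorem necklace_eq_iff {A : Type*} {w w' : List A} :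
    necklace w = necklace w' ↔ w.IsRotated w' := by
  constructor
  · intro h
    have : w' ∈ necklace w := h ▸ List.IsRotated.refl w'
    exact this
  · intro h
    ext u
    exact ⟨fun hu => h.symm.trans hu, fun hu => h.trans hu⟩

theorem isRotated_iff_exists_lt {A : Type*} {n : ℕ} (hn : 0 < n) {w w' : List A}
    (hw : w.length = n) : w.IsRotated w' ↔ ∃ i < n, w.rotate i = w' := by
  constructor
  · rintro ⟨i, hi⟩
    exact ⟨i % n, Nat.mod_lt _ hn, by rw [← hw, List.rotate_mod, hi]⟩
  · rintro ⟨i, -, hi⟩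
    exact ⟨i, hi⟩

/-- Burnside's lemma for necklaces. -/
theorem sum_ncard_rotate_eq {A : Type*} {n : ℕ} (hn : 0 < n) {S : Set (List A)} (hfin : S.Finite)
    (hlen : ∀ w ∈ S, w.length = n) (hrot : ∀ w ∈ S, ∀ i, w.rotate i ∈ S) :
    ∑ j ∈ Finset.range n, {w ∈ S | w.rotate j = w}.ncard = (necklace '' S).ncard * n := by
  classical
  obtain ⟨m, rfl⟩ : ∃ m, n = m + 1 := ⟨n - 1, by omega⟩
  let _ := rotationAction S hlen hrot
  have : Fintype S := hfin.fintype
  have hrel : ∀ w w' : S, (AddAction.orbitRel (ZMod (m + 1)) S) w w' ↔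
      necklace w.1 = necklace w'.1 := by
    intro w w'
    rw [AddAction.orbitRel_apply, eq_comm, necklace_eq_iff,
      isRotated_iff_exists_lt hn (hlen _ w'.2)]
    constructor
    · rintro ⟨a, rfl⟩
      exact ⟨a.val, ZMod.val_lt a, rfl⟩
    · rintro ⟨i, hi, h⟩
      refine ⟨(i : ZMod (m + 1)), Subtype.ext ?_⟩
      change w'.1.rotate (i : ZMod (m + 1)).val = w.1
      rw [ZMod.val_natCast, Nat.mod_eq_of_lt hi, h]
  have horb : Fintype.card (Quotient (AddAction.orbitRel (ZMod (m + 1)) S)) =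
      (necklace '' S).ncard := by
    rw [← Nat.card_eq_fintype_card, ← Nat.card_coe_set_eq]
    refine Nat.card_congr (Equiv.ofBijective
      (Quotient.lift (fun w : S => (⟨necklace w.1, w.1, w.2, rfl⟩ : necklace '' S))
        fun w w' h => Subtype.ext ((hrel w w').mp h)) ⟨?_, ?_⟩)
    · intro a b
      refine Quotient.inductionOn₂ a b fun w w' h => Quotient.sound ?_
      exact (hrel w w').mpr (congrArg Subtype.val h)
    · rintro ⟨_, w, hw, rfl⟩
      exact ⟨Quotient.mk _ ⟨w, hw⟩, rfl⟩
  have hb := AddAction.sum_card_fixedBy_eq_card_orbits_mul_card_addGroup (ZMod (m + 1)) S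
  rw [horb, ZMod.card] at hb
  rw [← hb, Finset.sum_range]
  refine Finset.sum_congr rfl fun a _ => ?_
  rw [Fintype.card_eq_nat_card, ← Nat.card_coe_set_eq]
  refine Nat.card_congr ⟨fun w => ⟨⟨w.1, w.2.1⟩, Subtype.ext w.2.2⟩,
    fun w => ⟨w.1.1, w.1.2, congrArg Subtype.val w.2⟩, fun _ => rfl, fun _ => rfl⟩

/-! ### Words fixed by a rotation -/

/-- The prefix of length `n` of `u u u …`. -/
def spread (n : ℕ) (u : List ℕ) : List ℕ := (List.range n).map (periodic u)

theorem length_spread (n : ℕ) (u : List ℕ) : (spread n u).length = n := by simp [spread]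

theorem getElem_spread (n : ℕ) (u : List ℕ) (i : ℕ) (h : i < (spread n u).length) :
    (spread n u)[i] = periodic u i := by simp [spread]

theorem periodic_congr {u : List ℕ} {i j : ℕ} (h : i ≡ j [MOD u.length]) :
    periodic u i = periodic u j := by
  unfold periodic
  rw [h]

theorem periodic_spread {n : ℕ} (hn : 0 < n) {u : List ℕ} (hd : u.length ∣ n) :
    periodic (spread n u) = periodic u := by
  funext i
  have h1 : i % n < n := Nat.mod_lt _ hn
  conv_lhs => rw [periodic, length_spread]
  rw [List.getD_eq_getElem _ _ (by rwa [length_spread]), getElem_spread]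
  exact periodic_congr ((Nat.mod_modEq i n).of_dvd hd)

theorem periodic_reverse {u : List ℕ} (hu : u ≠ []) (i : ℕ) :
    periodic u.reverse i = periodic u (u.length - 1 - i % u.length) := by
  have hlen := List.length_pos_iff.mpr hu
  have h1 : i % u.length < u.length := Nat.mod_lt _ hlen
  rw [← getElem_eq_periodic u _ (by omega)]
  conv_lhs => rw [periodic, List.length_reverse]
  rw [List.getD_eq_getElem _ _ (by simpa using h1), List.getElem_reverse]

theorem periodic_reverse_spread {n : ℕ} (hn : 0 < n) {u : List ℕ} (hu : u ≠ [])
    (hd : u.length ∣ n) : periodic (spread n u).reverse = periodic u.reverse := by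
  funext i
  have hlen := List.length_pos_iff.mpr hu
  have hne : spread n u ≠ [] := by
    rw [← List.length_pos_iff, length_spread]; exact hn
  rw [periodic_reverse hne, periodic_reverse hu, periodic_spread hn hd, length_spread]
  apply periodic_congr
  have h1 : i % n < n := Nat.mod_lt _ hn
  have h2 : i % u.length < u.length := Nat.mod_lt _ hlen
  have h3 : i % n + 1 ≡ i % u.length + 1 [MOD u.length] :=
    (((Nat.mod_modEq i n).of_dvd hd).trans (Nat.mod_modEq i u.length).symm).add_right 1
  refine Nat.ModEq.add_right_cancel h3 ?_
  rw [show n - 1 - i % n + (i % n + 1) = n by omega,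
    show u.length - 1 - i % u.length + (i % u.length + 1) = u.length by omega]
  exact ((Nat.modEq_zero_iff_dvd.mpr hd).trans (Nat.modEq_zero_iff_dvd.mpr dvd_rfl).symm)

theorem take_spread {n : ℕ} {u : List ℕ} (h : u.length ≤ n) : (spread n u).take u.length = u := by
  refine List.ext_getElem (by simp [length_spread, h]) fun i h1 h2 => ?_
  rw [List.getElem_take, getElem_spread, getElem_eq_periodic u i h2]

theorem rotate_gcd {A : Type*} {l : List A} {n j : ℕ} (hn : l.length = n) (hn0 : 0 < n)
    (h : l.rotate j = l) : l.rotate (Nat.gcd j n) = l := by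
  have key : ∀ m, l.rotate (j * m) = l := by
    intro m
    induction m with
    | zero => simp
    | succ m ih => rw [Nat.mul_succ, ← List.rotate_rotate, ih, h]
  rcases (Nat.gcd_le_right j hn0).lt_or_eq with h1 | h1
  · obtain ⟨m, -, hm⟩ := Nat.exists_mul_mod_eq_gcd h1
    rw [← hm, ← hn, List.rotate_mod, key]
  · rw [h1, ← hn, List.rotate_length]

theorem spread_take_gcd {l : List ℕ} {n j : ℕ} (hn : l.length = n) (hn0 : 0 < n)
    (h : l.rotate j = l) : spread n (l.take (Nat.gcd j n)) = l := by
  have hg := rotate_gcd hn hn0 h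
  have hgpos : 0 < Nat.gcd j n := Nat.gcd_pos_of_pos_right _ hn0
  have hgle : Nat.gcd j n ≤ n := Nat.gcd_le_right j hn0
  have hper : ∀ i, periodic l i = periodic l (i % Nat.gcd j n) := by
    intro i
    induction i using Nat.strong_induction_on with
    | _ i ih =>
      rcases Nat.lt_or_ge i (Nat.gcd j n) with hi | hi
      · rw [Nat.mod_eq_of_lt hi]
      · rw [Nat.mod_eq_sub_mod hi, ← ih (i - Nat.gcd j n) (by omega)]
        conv_rhs => rw [← hg, periodic_rotate, show Nat.gcd j n + (i - Nat.gcd j n) = i by omega]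
  have hlt : (l.take (Nat.gcd j n)).length = Nat.gcd j n := by simp [hn, hgle]
  refine List.ext_getElem (by rw [length_spread, hn]) fun i h1 h2 => ?_
  have hm := Nat.mod_lt i hgpos
  rw [getElem_spread, getElem_eq_periodic l, hper i, periodic, hlt,
    List.getD_eq_getElem _ _ (by omega), List.getElem_take, getElem_eq_periodic l]

theorem rotate_spread {n j : ℕ} (hn : 0 < n) {u : List ℕ} (hd : u.length ∣ n)
    (hj : u.length ∣ j) : (spread n u).rotate j = spread n u := by
  refine List.ext_getElem (by simp) fun i h1 h2 => ?_
  rw [getElem_eq_periodic, getElem_eq_periodic, periodic_rotate, periodic_spread hn hd]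
  apply periodic_congr
  have := (Nat.modEq_zero_iff_dvd.mpr hj).add_right i
  rwa [zero_add] at this

/-- The words of length `n` fixed by the rotation by `j` are the powers of words of length
`gcd j n`. -/
theorem ncard_rotate_eq {k n j : ℕ} (hn : 0 < n) (P : (ℕ → ℕ) → (ℕ → ℕ) → Prop) :
    {l ∈ (words k n : Set (List ℕ)) | l.rotate j = l ∧ P (periodic l) (periodic l.reverse)}.ncard =
    {u ∈ (words k (Nat.gcd j n) : Set (List ℕ)) |
      P (periodic u) (periodic u.reverse)}.ncard := by
  have hgpos : 0 < Nat.gcd j n := Nat.gcd_pos_of_pos_right _ hn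
  have hgle : Nat.gcd j n ≤ n := Nat.gcd_le_right j hn
  have himg : {l ∈ (words k n : Set (List ℕ)) |
      l.rotate j = l ∧ P (periodic l) (periodic l.reverse)} =
      spread n '' {u ∈ (words k (Nat.gcd j n) : Set (List ℕ)) |
        P (periodic u) (periodic u.reverse)} := by
    ext l
    simp only [Set.mem_ofPred_eq, Finset.mem_coe, Set.mem_image, mem_words]
    constructor
    · rintro ⟨⟨hl, hk⟩, hr, hP⟩
      have hs := spread_take_gcd hl hn hr
      have hlen : (l.take (Nat.gcd j n)).length = Nat.gcd j n := by simp [hl, hgle]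
      refine ⟨l.take (Nat.gcd j n), ⟨⟨hlen, fun a ha => hk a (List.mem_of_mem_take ha)⟩, ?_⟩, hs⟩
      have hd : (l.take (Nat.gcd j n)).length ∣ n := by rw [hlen]; exact Nat.gcd_dvd_right _ _
      rw [← periodic_spread hn hd, ← periodic_reverse_spread hn (by
        rw [← List.length_pos_iff, hlen]; exact hgpos) hd, hs]
      exact hP
    · rintro ⟨u, ⟨⟨hu, hk⟩, hP⟩, rfl⟩
      have hd : u.length ∣ n := by rw [hu]; exact Nat.gcd_dvd_right _ _
      have hne : u ≠ [] := by rw [← List.length_pos_iff, hu]; exact hgpos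
      refine ⟨⟨length_spread _ _, fun a ha => ?_⟩,
        rotate_spread hn hd (by rw [hu]; exact Nat.gcd_dvd_left _ _), ?_⟩
      · obtain ⟨i, hi, rfl⟩ := List.mem_iff_getElem.mp ha
        rw [getElem_spread, periodic, List.getD_eq_getElem _ _ (Nat.mod_lt _ (by omega))]
        exact hk _ (List.getElem_mem _)
      · rwa [periodic_spread hn hd, periodic_reverse_spread hn hne hd]
  rw [himg, Set.InjOn.ncard_image]
  intro u hu u' hu' h
  have h1 := (mem_words.mp hu.1).1
  have h2 := (mem_words.mp hu'.1).1
  rw [← take_spread (n := n) (u := u) (by omega), ← take_spread (n := n) (u := u') (by omega), h,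
    h1, h2]

/-! ### Letter codes and lexicographic comparison -/

theorem letterCode_strictMono {A : Type*} [LinearOrder A] [Fintype A] :
    StrictMono (letterCode : A → ℕ) := by
  intro a b hab
  refine Finset.card_lt_card ⟨fun c hc => ?_, fun h => ?_⟩
  · simp only [Finset.mem_filter, Finset.mem_univ, true_and] at hc ⊢
    exact hc.trans hab
  · have := h (Finset.mem_filter.mpr ⟨Finset.mem_univ a, hab⟩)
    simp at this

theorem letterCode_lt {A : Type*} [LinearOrder A] [Fintype A] (a : A) :
    letterCode a < Fintype.card A :=
  Finset.card_lt_univ_of_notMem (x := a) (by simp)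

theorem exists_letterCode_eq {A : Type*} [LinearOrder A] [Fintype A] {c : ℕ}
    (hc : c < Fintype.card A) : ∃ a : A, letterCode a = c := by
  let f : A → Fin (Fintype.card A) := fun a => ⟨letterCode a, letterCode_lt a⟩
  have hf : Function.Injective f := fun a b h =>
    letterCode_strictMono.injective (congrArg Fin.val h)
  have hbij := (Fintype.bijective_iff_injective_and_card f).mpr ⟨hf, by simp⟩
  obtain ⟨a, ha⟩ := hbij.2 ⟨c, hc⟩
  exact ⟨a, congrArg Fin.val ha⟩

theorem image_map_letterCode {A : Type*} [LinearOrder A] [Fintype A] (n : ℕ) :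
    List.map letterCode '' {w : List A | w.length = n} = words (Fintype.card A) n := by
  ext l
  simp only [Set.mem_image, Set.mem_ofPred_eq, Finset.mem_coe, mem_words]
  constructor
  · rintro ⟨w, rfl, rfl⟩
    refine ⟨by simp, fun a ha => ?_⟩
    obtain ⟨b, -, rfl⟩ := List.mem_map.mp ha
    exact letterCode_lt b
  · rintro ⟨hl, hk⟩
    have : l ∈ Set.range (List.map (letterCode : A → ℕ)) := by
      rw [Set.range_list_map]
      exact fun a ha => exists_letterCode_eq (hk a ha)
    obtain ⟨w, rfl⟩ := this
    exact ⟨w, by simpa using hl, rfl⟩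

/-- Comparison of words of equal length by the codes of their letters. -/
theorem lt_iff_exists_code {A : Type*} [LinearOrder A] [Fintype A] {n : ℕ} {r v : List A}
    (hr : r.length = n) (hv : v.length = n) : r < v ↔ ∃ i < n,
      (∀ l < i, (r.map letterCode).getD l 0 = (v.map letterCode).getD l 0) ∧
      (r.map letterCode).getD i 0 < (v.map letterCode).getD i 0 := by
  have hget : ∀ (w : List A) i (h : i < w.length),
      (w.map letterCode).getD i 0 = letterCode w[i] := by
    intro w i h
    rw [List.getD_eq_getElem _ _ (by simpa using h), List.getElem_map]
  rw [List.lt_iff_exists]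
  constructor
  · rintro (⟨-, h⟩ | ⟨i, h1, h2, h3, h4⟩)
    · omega
    · refine ⟨i, by omega, fun l hl => ?_, ?_⟩
      · rw [hget r l (by omega), hget v l (by omega), h3 l hl]
      · rw [hget r i h1, hget v i h2]
        exact letterCode_strictMono h4
  · rintro ⟨i, hi, h3, h4⟩
    refine Or.inr ⟨i, by omega, by omega, fun l hl => ?_, ?_⟩
    · have := h3 l hl
      rw [hget r l (by omega), hget v l (by omega)] at this
      exact letterCode_strictMono.injective this
    · rw [hget r i (by omega), hget v i (by omega)] at h4
      exact letterCode_strictMono.lt_iff_lt.mp h4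

/-- `v 0, …, v (n - 1)` with the last letter increased by one. The words larger than `v` are
those that are at least this word, even if its last letter lies outside the alphabet. -/
def bump (v : ℕ → ℕ) (n : ℕ) : ℕ → ℕ := Function.update v (n - 1) (v (n - 1) + 1)

/-- The codes of the letters of a word, extended by zeros. -/
def code {A : Type*} [LinearOrder A] [Fintype A] (v : List A) (i : ℕ) : ℕ :=
  (v.map letterCode).getD i 0

theorem not_lt_iff {A : Type*} [LinearOrder A] [Fintype A] {n : ℕ} {r v : List A}
    (hr : r.length = n) (hv : v.length = n) : ¬ r < v ↔
      ∀ j < n, (∀ l < j, code r l = code v l) → code v j ≤ code r j := by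
  rw [lt_iff_exists_code hr hv]
  push Not
  rfl

theorem lt_iff_bump {A : Type*} [LinearOrder A] [Fintype A] {n : ℕ} (hn : 0 < n) {r v : List A}
    (hr : r.length = n) (hv : v.length = n) : v < r ↔
      ∀ j < n, (∀ l < j, code r l = bump (code v) n l) → bump (code v) n j ≤ code r j := by
  have hb : ∀ l, l ≠ n - 1 → bump (code v) n l = code v l := fun l hl =>
    Function.update_of_ne hl _ _
  have hb' : bump (code v) n (n - 1) = code v (n - 1) + 1 := Function.update_self _ _ _
  constructor
  · intro h j hj hmatch
    obtain ⟨i, hi, h1, h2⟩ := (lt_iff_exists_code hv hr).mp h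
    change ∀ l < i, code v l = code r l at h1
    change code v i < code r i at h2
    rcases lt_trichotomy j i with hji | rfl | hji
    · rw [hb j (by omega), h1 j hji]
    · rcases eq_or_ne j (n - 1) with rfl | hne
      · rw [hb']; exact h2
      · rw [hb j hne]; exact h2.le
    · have := hmatch i hji
      rw [hb i (by omega)] at this
      omega
  · intro h
    by_contra hlt
    rcases (not_lt.mp hlt).lt_or_eq with h1 | h1
    · obtain ⟨i, hi, h2, h3⟩ := (lt_iff_exists_code hr hv).mp h1
      change ∀ l < i, code r l = code v l at h2
      change code r i < code v i at h3
      have h4 := h i hi fun l hl => by rw [hb l (by omega), h2 l hl]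
      rcases eq_or_ne i (n - 1) with rfl | hne
      · rw [hb'] at h4; omega
      · rw [hb i hne] at h4; omega
    · subst h1
      have := h (n - 1) (by omega) fun l hl => by rw [hb l (by omega)]
      rw [hb'] at this
      omega

theorem code_rotate {A : Type*} [LinearOrder A] [Fintype A] {w : List A} {i l : ℕ}
    (hl : l < w.length) : code (w.rotate i) l = periodic (w.map letterCode) (i + l) := by
  rw [← periodic_rotate, code, List.map_rotate, periodic, List.length_rotate, List.length_map,
    Nat.mod_eq_of_lt hl]

theorem forall_rotation_not_lt_iff {A : Type*} [LinearOrder A] [Fintype A] {n : ℕ}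
    {w v : List A} (hw : w.length = n) (hv : v.length = n) :
    (∀ r, w.IsRotated r → ¬ r < v) ↔
      FactorsGe (code v) n (periodic (w.map letterCode)) := by
  constructor
  · intro h i j hj hm
    have := (not_lt_iff (by simpa using hw) hv).mp (h (w.rotate i) ⟨i, rfl⟩) j hj fun l hl => by
      rw [code_rotate (by omega), hm l hl]
    rwa [code_rotate (by omega)] at this
  · rintro h r ⟨i, rfl⟩
    rw [not_lt_iff (by simpa using hw) hv]
    intro j hj hm
    rw [code_rotate (by omega)]
    exact h i j hj fun l hl => by rw [← code_rotate (by omega), hm l hl]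

theorem forall_rotation_lt_iff {A : Type*} [LinearOrder A] [Fintype A] {n : ℕ} (hn : 0 < n)
    {w v : List A} (hw : w.length = n) (hv : v.length = n) :
    (∀ r, w.IsRotated r → v < r) ↔
      FactorsGe (bump (code v) n) n (periodic (w.map letterCode)) := by
  constructor
  · intro h i j hj hm
    have := (lt_iff_bump hn (by simpa using hw) hv).mp (h (w.rotate i) ⟨i, rfl⟩) j hj
      fun l hl => by rw [code_rotate (by omega), hm l hl]
    rwa [code_rotate (by omega)] at this
  · rintro h r ⟨i, rfl⟩
    rw [lt_iff_bump hn (by simpa using hw) hv]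
    intro j hj hm
    rw [code_rotate (by omega)]
    exact h i j hj fun l hl => by rw [← code_rotate (by omega), hm l hl]

/-! ### Enclosing bracelets and their smaller necklaces -/

/-- The words of length `n` with a rotation smaller than `v` such that all rotations of their
reversals are larger than `v`. -/
def lowerWords {A : Type*} [LinearOrder A] (n : ℕ) (v : List A) : Set (List A) :=
  {w | w.length = n ∧ (¬ ∀ r, w.IsRotated r → ¬ r < v) ∧ ∀ r, w.reverse.IsRotated r → v < r}

theorem exists_isNecklaceRep {A : Type*} [LinearOrder A] (w : List A) :
    ∃ r, IsNecklaceRep w r := by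
  have hfin : (necklace w).Finite := by
    refine ((Set.finite_le_nat w.length).image fun i => w.rotate i).subset ?_
    intro u hu
    obtain ⟨i, hi, h⟩ := List.isRotated_iff_mod.mp hu
    exact ⟨i, hi, h⟩
  obtain ⟨r, hr, h⟩ := Set.exists_min_image (necklace w) id hfin ⟨w, List.IsRotated.refl w⟩
  exact ⟨r, hr, h⟩

theorem bracelet_eq_of_mem {A : Type*} {a w : List A} (h : a ∈ bracelet w) :
    bracelet a = bracelet w := by
  have key : ∀ a w : List A, a ∈ bracelet w → bracelet a ⊆ bracelet w := by
    rintro a w (h | ⟨c, hc, rfl⟩) u (hu | ⟨d, hd, rfl⟩)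
    · exact Or.inl (h.trans hu)
    · exact Or.inr ⟨d, h.trans hd, rfl⟩
    · refine Or.inr ⟨u.reverse, ?_, List.reverse_reverse u⟩
      exact hc.trans (List.isRotated_reverse_comm_iff.mp hu)
    · refine Or.inl (hc.trans ?_)
      have := List.IsRotated.reverse hd
      rwa [List.reverse_reverse] at this
  refine Set.Subset.antisymm (key a w h) (key w a ?_)
  rcases h with h | ⟨c, hc, rfl⟩
  · exact Or.inl (List.IsRotated.symm h)
  · exact Or.inr ⟨w.reverse, (List.IsRotated.symm hc).reverse, List.reverse_reverse w⟩

theorem enclosingBracelets_eq_image {A : Type*} [LinearOrder A] (n : ℕ) (v : List A) :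
    enclosingBracelets n v = bracelet '' lowerWords n v := by
  ext B
  constructor
  · rintro ⟨⟨w, hw, rfl⟩, a, ha, b, hb, r, s, hr, hs, hrv, hvs⟩
    have hBa := bracelet_eq_of_mem ha
    have hlen : ∀ c ∈ bracelet w, c.length = n := by
      rintro c (h | ⟨d, h, rfl⟩)
      · rw [← List.IsRotated.perm h |>.length_eq, hw]
      · rw [List.length_reverse, ← List.IsRotated.perm h |>.length_eq, hw]
    refine ⟨a, ⟨hlen a ha, fun h => h r hr.1 hrv, fun t ht => ?_⟩, hBa⟩
    rw [← hBa] at hb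
    rcases hb with hb | ⟨c, hc, rfl⟩
    · have h1 : r = s := hr.unique (by rw [IsNecklaceRep, ← necklace_eq_iff.mpr hb] at hs; exact hs)
      exact absurd (hrv.trans hvs) (by simp [h1])
    · exact hvs.trans_le (hs.2 ((List.IsRotated.reverse hc).symm.trans ht))
  · rintro ⟨w, ⟨hw, h1, h2⟩, rfl⟩
    obtain ⟨r, hr⟩ := exists_isNecklaceRep w
    obtain ⟨s, hs⟩ := exists_isNecklaceRep w.reverse
    refine ⟨⟨w, hw, rfl⟩, w, Or.inl (List.IsRotated.refl w), w.reverse,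
      Or.inr ⟨w, List.IsRotated.refl w, rfl⟩, r, s, hr, hs, ?_, h2 s hs.1⟩
    push Not at h1
    obtain ⟨t, ht, htv⟩ := h1
    exact (hr.2 ht).trans_lt htv

/-- An enclosing bracelet has exactly one necklace with representative smaller than `v`. -/
theorem ncard_enclosingBracelets {A : Type*} [LinearOrder A] (n : ℕ) (v : List A) :
    (enclosingBracelets n v).ncard = (necklace '' lowerWords n v).ncard := by
  have h : enclosingBracelets n v =
      (fun N : Set (List A) => N ∪ List.reverse '' N) '' (necklace '' lowerWords n v) := by
    rw [enclosingBracelets_eq_image, Set.image_image]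
    rfl
  rw [h, Set.InjOn.ncard_image]
  rintro _ ⟨w, hw, rfl⟩ _ ⟨w', hw', rfl⟩ heq
  change bracelet w = bracelet w' at heq
  have hmem : w' ∈ bracelet w := by
    rw [heq]
    exact Or.inl (List.IsRotated.refl w')
  rcases hmem with h1 | ⟨c, hc, rfl⟩
  · exact necklace_eq_iff.mpr h1
  · -- the reversal of a word in `lowerWords` has no rotation smaller than `v`
    refine absurd ?_ hw'.2.1
    intro r hr
    exact (hw.2.2 r ((List.IsRotated.reverse hc).trans hr)).le.not_gt

theorem mem_lowerWords_iff {A : Type*} [LinearOrder A] [Fintype A] {n : ℕ} (hn : 0 < n)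
    {v : List A} (hv : v.length = n) {px py : ℕ} (hx : IsLyndonRoot (code v) n px)
    (hy : IsLyndonRoot (bump (code v) n) n py) (w : List A) :
    w ∈ lowerWords n v ↔ w.length = n ∧
      ¬ SuffixesGe (code v) px (periodic (w.map letterCode)) ∧
      SuffixesGe (bump (code v) n) py (periodic (w.map letterCode).reverse) := by
  refine and_congr_right fun hw => ?_
  rw [forall_rotation_not_lt_iff hw hv, forall_rotation_lt_iff hn (by simpa using hw) hv,
    hx.factorsGe_iff, hy.factorsGe_iff, List.map_reverse]

theorem isLyndon_zero : IsLyndon (fun _ => 0) 1 := ⟨one_pos, fun q h h' => by omega⟩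

theorem closed_zero (u : List ℕ) : Closed (fun _ => 0) 1 u := by
  refine ⟨0, one_pos, ?_⟩
  induction u with
  | nil => rfl
  | cons b u ih =>
    rw [run_cons_eq_some]
    have : next (fun _ => 0) 1 0 b = 0 := Nat.lt_one_iff.mp (next_lt one_pos _ _)
    rw [this]
    exact ⟨Nat.zero_le _, ih⟩

theorem IsLyndonRoot.isLyndon {v : ℕ → ℕ} {n p : ℕ} (h : IsLyndonRoot v n p) : IsLyndon v p :=
  h.choose_spec.2.1.1

/-- The words with closed runs split into those that are closed for a Lyndon word `x` as well, and
the others. -/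
theorem card_closedWords_zero {x : ℕ → ℕ} {px : ℕ} (hx : IsLyndon x px) {y : ℕ → ℕ} {py : ℕ}
    (hy : IsLyndon y py) (k : ℕ) {d : ℕ} (hd : 0 < d) :
    (closedWords (fun _ => 0) 1 y py k d).card =
      {u ∈ (words k d : Set (List ℕ)) |
        ¬ SuffixesGe x px (periodic u) ∧ SuffixesGe y py (periodic u.reverse)}.ncard +
      (closedWords x px y py k d).card := by
  classical
  have h1 : {u ∈ (words k d : Set (List ℕ)) |
        ¬ SuffixesGe x px (periodic u) ∧ SuffixesGe y py (periodic u.reverse)} =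
      ((closedWords (fun _ => 0) 1 y py k d \ closedWords x px y py k d : Finset _) :
        Set (List ℕ)) := by
    ext u
    simp only [Set.mem_ofPred_eq, Finset.mem_coe, Finset.mem_sdiff, mem_closedWords]
    by_cases hu : u ∈ words k d
    · have hne : u ≠ [] := by
        rw [← List.length_pos_iff, (mem_words.mp hu).1]; exact hd
      rw [closed_iff_suffixesGe hx hne, closed_iff_suffixesGe hy (by simpa using hne)]
      have := closed_zero u
      tauto
    · tauto
  rw [h1, Set.ncard_coe_finset, Finset.card_sdiff_add_card_eq_card]
  intro u hu
  rw [mem_closedWords] at hu ⊢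
  exact ⟨hu.1, closed_zero u, hu.2.2⟩

/-- The number of enclosing bracelets, times `n`, as a difference of two sums over all rotations
of the numbers of closed words that they fix. -/
theorem sum_card_closedWords {A : Type*} [LinearOrder A] [Fintype A] {n : ℕ} (hn : 0 < n)
    {v : List A} (hv : v.length = n) {px py : ℕ} (hx : IsLyndonRoot (code v) n px)
    (hy : IsLyndonRoot (bump (code v) n) n py) :
    ∑ j ∈ Finset.range n,
        (closedWords (fun _ => 0) 1 (bump (code v) n) py (Fintype.card A) (Nat.gcd j n)).card =
      (enclosingBracelets n v).ncard * n + ∑ j ∈ Finset.range n,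
        (closedWords (code v) px (bump (code v) n) py (Fintype.card A) (Nat.gcd j n)).card := by
  have hmem := mem_lowerWords_iff hn hv hx hy
  have hinj : Function.Injective (List.map (RAM.letterCode : A → ℕ)) :=
    List.map_injective_iff.mpr letterCode_strictMono.injective
  have hlen : ∀ w ∈ lowerWords n v, w.length = n := fun w hw => hw.1
  have hfin : (lowerWords n v).Finite := by
    refine Set.Finite.of_finite_image (f := List.map RAM.letterCode) ?_ hinj.injOn
    refine (words (Fintype.card A) n).finite_toSet.subset ?_
    rw [← image_map_letterCode]
    exact Set.image_mono hlen
  have hrot : ∀ w ∈ lowerWords n v, ∀ i, w.rotate i ∈ lowerWords n v := by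
    rintro w ⟨h1, h2, h3⟩ i
    refine ⟨by simpa using h1, fun h => h2 fun r hr => h r ?_, fun r hr => h3 r ?_⟩
    · exact (List.IsRotated.symm ⟨i, rfl⟩).trans hr
    · exact (List.IsRotated.reverse ⟨i, rfl⟩).trans hr
  rw [ncard_enclosingBracelets, ← sum_ncard_rotate_eq hn hfin hlen hrot, ← Finset.sum_add_distrib]
  refine Finset.sum_congr rfl fun j _ => ?_
  rw [card_closedWords_zero hx.isLyndon hy.isLyndon _ (Nat.gcd_pos_of_pos_right _ hn)]
  congr 1
  have h := ncard_rotate_eq (k := Fintype.card A) (j := j) hn fun z z' =>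
    ¬ SuffixesGe (code v) px z ∧ SuffixesGe (bump (code v) n) py z'
  rw [← h, ← Set.InjOn.ncard_image (f := List.map RAM.letterCode) hinj.injOn]
  congr 1
  ext l
  simp only [Set.mem_ofPred_eq, ← image_map_letterCode, Set.mem_image]
  constructor
  · rintro ⟨⟨w, hw, rfl⟩, hr, hP⟩
    refine ⟨w, ⟨(hmem w).mpr ⟨hw, hP⟩, ?_⟩, rfl⟩
    rw [← List.map_rotate] at hr
    exact hinj hr
  · rintro ⟨w, ⟨hw, hr⟩, rfl⟩
    have h1 := (hmem w).mp hw
    exact ⟨⟨w, h1.1, rfl⟩, by rw [← List.map_rotate, hr], h1.2⟩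

/-! ### A program logic with time bounds -/

/-- Started in `σ`, the program `P` halts after at most `c` time units in a state that
satisfies `Q`. -/
def Terminates (P : Prog) (σ : State) (c : ℕ) (Q : State → Prop) : Prop :=
  ∃ τ t, Run P σ τ t ∧ t ≤ c ∧ Q τ

/-- The variables to which a program assigns. -/
def assigned : Prog → List ℕ
  | .skip => []
  | .assign x _ => [x]
  | .store _ _ _ => []
  | .seq p q => assigned p ++ assigned q
  | .ifLt _ _ p q => assigned p ++ assigned q
  | .whileLt _ _ p => assigned p

/-- The arrays into which a program stores. -/
def stored : Prog → List ℕ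
  | .skip => []
  | .assign _ _ => []
  | .store a _ _ => [a]
  | .seq p q => stored p ++ stored q
  | .ifLt _ _ p q => stored p ++ stored q
  | .whileLt _ _ p => stored p

/-- The states `σ` and `τ` agree except on the variables `vs` and the arrays `as`. -/
def Frame (vs as : List ℕ) (σ τ : State) : Prop :=
  (∀ x, x ∉ vs → τ.var x = σ.var x) ∧ ∀ a, a ∉ as → τ.arr a = σ.arr a

theorem Frame.refl (vs as : List ℕ) (σ : State) : Frame vs as σ σ :=
  ⟨fun _ _ => rfl, fun _ _ => rfl⟩

theorem Frame.trans {vs as : List ℕ} {σ τ υ : State} (h : Frame vs as σ τ)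
    (h' : Frame vs as τ υ) : Frame vs as σ υ :=
  ⟨fun x hx => (h'.1 x hx).trans (h.1 x hx), fun a ha => (h'.2 a ha).trans (h.2 a ha)⟩

theorem Frame.mono {vs as vs' as' : List ℕ} {σ τ : State} (h : Frame vs as σ τ)
    (hv : vs ⊆ vs') (ha : as ⊆ as') : Frame vs' as' σ τ :=
  ⟨fun x hx => h.1 x fun h' => hx (hv h'), fun a ha' => h.2 a fun h' => ha' (ha h')⟩

@[simp] theorem setVar_arr (σ : State) (x m : ℕ) : (σ.setVar x m).arr = σ.arr := rfl

@[simp] theorem setArr_var (σ : State) (a i m : ℕ) : (σ.setArr a i m).var = σ.var := rfl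

theorem setVar_var (σ : State) (x m y : ℕ) :
    (σ.setVar x m).var y = if y = x then m else σ.var y := by
  simp [State.setVar, Function.update_apply]

theorem setArr_arr (σ : State) (a i m b : ℕ) :
    (σ.setArr a i m).arr b = if b = a then Function.update (σ.arr a) i m else σ.arr b := by
  simp [State.setArr, Function.update_apply]

/-- A run changes only the variables and arrays that occur as targets in the program. -/
theorem Run.frame {P : Prog} {σ τ : State} {t : ℕ} (h : Run P σ τ t) :
    Frame (assigned P) (stored P) σ τ := by
  induction h with
  | skip σ => exact Frame.refl _ _ _
  | assign σ x e =>
    refine ⟨fun y hy => ?_, fun _ _ => rfl⟩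
    rw [setVar_var, if_neg (by simpa [assigned] using hy)]
  | store σ a i e =>
    refine ⟨fun _ _ => rfl, fun b hb => ?_⟩
    rw [setArr_arr, if_neg (by simpa [stored] using hb)]
  | seq _ _ ih1 ih2 =>
    exact (ih1.mono (by simp [assigned]) (by simp [stored])).trans
      (ih2.mono (by simp [assigned]) (by simp [stored]))
  | ifTrue _ _ ih => exact ih.mono (by simp [assigned]) (by simp [stored])
  | ifFalse _ _ ih => exact ih.mono (by simp [assigned]) (by simp [stored])
  | whileTrue _ _ _ ih1 ih2 => exact Frame.trans ih1 ih2
  | whileFalse => exact Frame.refl _ _ _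

theorem Terminates.mono {P : Prog} {σ : State} {c c' : ℕ} {Q Q' : State → Prop}
    (h : Terminates P σ c Q) (hc : c ≤ c')
    (hQ : ∀ τ, Frame (assigned P) (stored P) σ τ → Q τ → Q' τ) : Terminates P σ c' Q' := by
  obtain ⟨τ, t, h1, h2, h3⟩ := h
  exact ⟨τ, t, h1, h2.trans hc, hQ τ (Run.frame h1) h3⟩

theorem Terminates.seq {P P' : Prog} {σ : State} {c c' : ℕ} {R Q : State → Prop}
    (h : Terminates P σ c R)
    (h' : ∀ τ, Frame (assigned P) (stored P) σ τ → R τ → Terminates P' τ c' Q) :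
    Terminates (.seq P P') σ (c + c') Q := by
  obtain ⟨τ, t, h1, h2, h3⟩ := h
  obtain ⟨υ, u, h4, h5, h6⟩ := h' τ (Run.frame h1) h3
  exact ⟨υ, t + u, .seq h1 h4, add_le_add h2 h5, h6⟩

/-- The program contains no loop. -/
def loopFree : Prog → Bool
  | .skip => true
  | .assign _ _ => true
  | .store _ _ _ => true
  | .seq p q => loopFree p && loopFree q
  | .ifLt _ _ p q => loopFree p && loopFree q
  | .whileLt _ _ _ => false

/-- The effect of a program without loops. The value for a loop is irrelevant. -/
def exec : Prog → State → State
  | .skip, σ => σ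
  | .assign x e, σ => σ.setVar x (e.eval σ)
  | .store a i e, σ => σ.setArr a (i.eval σ) (e.eval σ)
  | .seq p q, σ => exec q (exec p σ)
  | .ifLt e f p q, σ => if e.eval σ < f.eval σ then exec p σ else exec q σ
  | .whileLt _ _ _, σ => σ

/-- An upper bound for the time used by a program without loops. The value for a loop is
irrelevant. -/
def timeBound : Prog → ℕ
  | .skip => 1
  | .assign _ e => e.cost + 1
  | .store _ i e => i.cost + e.cost + 1
  | .seq p q => timeBound p + timeBound q
  | .ifLt e f p q => e.cost + f.cost + 1 + (timeBound p + timeBound q)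
  | .whileLt _ _ _ => 0

theorem terminates_exec (P : Prog) (h : loopFree P = true) (σ : State) :
    Terminates P σ (timeBound P) fun τ => τ = exec P σ := by
  induction P generalizing σ with
  | skip => exact ⟨_, _, .skip σ, le_rfl, rfl⟩
  | assign x e => exact ⟨_, _, .assign σ x e, le_rfl, rfl⟩
  | store a i e => exact ⟨_, _, .store σ a i e, le_rfl, rfl⟩
  | seq p q ihp ihq =>
    simp only [loopFree, Bool.and_eq_true] at h
    exact (ihp h.1 σ).seq fun τ _ hτ => by rw [hτ]; exact ihq h.2 _
  | ifLt e f p q ihp ihq =>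
    simp only [loopFree, Bool.and_eq_true] at h
    by_cases hlt : e.eval σ < f.eval σ
    · obtain ⟨τ, t, h1, h2, h3⟩ := ihp h.1 σ
      refine ⟨τ, _, .ifTrue hlt h1, ?_, by rw [exec, if_pos hlt, h3]⟩
      simp only [timeBound]; omega
    · obtain ⟨τ, t, h1, h2, h3⟩ := ihq h.2 σ
      refine ⟨τ, _, .ifFalse hlt h1, ?_, by rw [exec, if_neg hlt, h3]⟩
      simp only [timeBound]; omega
  | whileLt => simp [loopFree] at h

theorem Terminates.of_exec {P : Prog} {σ : State} {c : ℕ} {Q : State → Prop}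
    (h : loopFree P = true) (hc : timeBound P ≤ c) (hQ : Q (exec P σ)) : Terminates P σ c Q :=
  (terminates_exec P h σ).mono hc fun τ _ hτ => by rw [hτ]; exact hQ

/-- The rule for loops, with an invariant `I` and a variant `m` that bounds the number of passes. -/
theorem Terminates.whileLt {e f : Expr} {P : Prog} {σ : State} {c : ℕ} {Q : State → Prop}
    (I : State → Prop) (m : State → ℕ) (h0 : I σ)
    (hstep : ∀ τ, I τ → e.eval τ < f.eval τ → Terminates P τ c fun υ => I υ ∧ m υ < m τ)
    (hQ : ∀ τ, I τ → ¬ e.eval τ < f.eval τ → Q τ) :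
    Terminates (.whileLt e f P) σ ((m σ + 1) * (c + (e.cost + f.cost + 1))) Q := by
  induction hm : m σ using Nat.strong_induction_on generalizing σ with
  | _ N ih =>
    by_cases hlt : e.eval σ < f.eval σ
    · obtain ⟨τ, t, h1, h2, h3, h4⟩ := hstep σ h0 hlt
      obtain ⟨υ, u, h5, h6, h7⟩ := ih (m τ) (hm ▸ h4) h3 rfl
      refine ⟨υ, _, .whileTrue hlt h1 h5, ?_, h7⟩
      have h8 : (m τ + 1) * (c + (e.cost + f.cost + 1)) ≤ N * (c + (e.cost + f.cost + 1)) :=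
        Nat.mul_le_mul_right _ (by omega)
      rw [Nat.succ_mul]
      omega
    · refine ⟨σ, _, .whileFalse hlt, ?_, hQ σ h0 hlt⟩
      rw [Nat.succ_mul]
      omega

/-- `for i = 0, …, N - 1 do P`, where `N` is the value of a variable. -/
def forLt (i N : ℕ) (P : Prog) : Prog :=
  .seq (.assign i (.num 0))
    (.whileLt (.var i) (.var N) (.seq P (.assign i (.add (.var i) (.num 1)))))

/-- The rule for counting loops, with an invariant that depends on the number of passes. It has to
hold after the increment of the loop variable. If there are at most `M` passes of cost `c`, then the
factor `20` covers the overhead, as `M` and `c` are positive. -/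
theorem Terminates.forLt {i N : ℕ} {P : Prog} {σ : State} {c M : ℕ} {Q : State → Prop}
    (I : ℕ → State → Prop) (hc : 1 ≤ c) (hNM : σ.var N ≤ M) (hM : 1 ≤ M)
    (hi : i ∉ N :: assigned P) (hN : N ∉ assigned P) (h0 : I 0 (σ.setVar i 0))
    (hstep : ∀ j < σ.var N, ∀ τ, Frame (i :: assigned P) (stored P) σ τ → τ.var i = j → I j τ →
      Terminates P τ c fun υ => I (j + 1) (υ.setVar i (j + 1)))
    (hQ : ∀ τ, Frame (i :: assigned P) (stored P) σ τ → I (σ.var N) τ → Q τ) :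
    Terminates (EnclosingCount.forLt i N P) σ (20 * (M * c)) Q := by
  simp only [List.mem_cons, not_or] at hi
  have hassign : Terminates (.assign i (.num 0)) σ 2 fun τ => τ = σ.setVar i 0 :=
    ⟨_, _, .assign σ i _, le_rfl, rfl⟩
  have hmain := hassign.seq (P' := .whileLt (.var i) (.var N)
    (.seq P (.assign i (.add (.var i) (.num 1))))) (Q := Q)
    (c' := (σ.var N + 1) * (c + 4 + (1 + 1 + 1))) fun τ _ hτ => ?_
  · refine hmain.mono ?_ fun τ _ h => h
    have h1 : (σ.var N + 1) * (c + 4 + (1 + 1 + 1)) ≤ (2 * M) * (8 * c) :=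
      Nat.mul_le_mul (by omega) (by omega)
    have h2 : 1 ≤ M * c := Nat.mul_pos hM hc
    have h3 : (2 * M) * (8 * c) = 16 * (M * c) := by ring
    omega
  · have hw := Terminates.whileLt (e := .var i) (f := .var N)
      (P := .seq P (.assign i (.add (.var i) (.num 1)))) (σ := τ) (c := c + 4) (Q := Q)
      (fun υ => Frame (i :: assigned P) (stored P) σ υ ∧ υ.var i ≤ σ.var N ∧ I (υ.var i) υ)
      (fun υ => σ.var N - υ.var i) ?_ ?_ ?_
    · refine hw.mono ?_ fun τ _ h => h
      exact Nat.mul_le_mul (by simp) le_rfl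
    · subst hτ
      refine ⟨⟨fun x hx => ?_, fun _ _ => rfl⟩, by simp [setVar_var],
        by simpa [setVar_var] using h0⟩
      rw [setVar_var, if_neg (by simp_all)]
    · rintro υ ⟨hf, hle, hI⟩ hlt
      simp only [Expr.eval] at hlt
      have hNe : υ.var N = σ.var N := hf.1 N (by simp [hN, Ne.symm hi.1])
      refine (hstep (υ.var i) (by omega) υ hf rfl hI).seq fun ω hfr hω => ?_
      refine ⟨_, _, .assign ω i _, le_rfl, ?_⟩
      have hiv : ω.var i = υ.var i := hfr.1 i hi.2
      simp only [Expr.eval, setVar_var, if_true, hiv]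
      refine ⟨⟨hf.trans ⟨fun x hx => ?_, fun a ha => hfr.2 a ha⟩, by omega, hω⟩, by omega⟩
      simp only [List.mem_cons, not_or] at hx
      rw [setVar_var, if_neg hx.1]
      exact hfr.1 x hx.2
    · rintro υ ⟨hf, hle, hI⟩ hlt
      simp only [Expr.eval] at hlt
      have hNe : υ.var N = σ.var N := hf.1 N (by simp [hN, Ne.symm hi.1])
      have : υ.var i = σ.var N := by omega
      exact hQ υ hf (this ▸ hI)

/-! ### The program: Lyndon roots -/

/-- Duval's algorithm for the word in array `0`, whose length is variable `0`. The length of the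
Lyndon root is stored in variable `2`. -/
def lyndonRootProg : Prog :=
  .seq (.assign 2 (.num 1)) <| .seq (.assign 5 (.num 1)) <| .whileLt (.var 5) (.var 0) <|
    .ifLt (.get 0 (.var 5)) (.get 0 (.sub (.var 5) (.var 2))) (.assign 5 (.var 0)) <|
      .seq (.ifLt (.get 0 (.sub (.var 5) (.var 2))) (.get 0 (.var 5))
        (.assign 2 (.add (.var 5) (.num 1))) .skip) (.assign 5 (.add (.var 5) (.num 1)))

theorem terminates_lyndonRootProg {σ : State} {n : ℕ} (hσ : σ.var 0 = n) (hn : 1 ≤ n) :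
    Terminates lyndonRootProg σ (200 * n) fun τ => IsLyndonRoot (σ.arr 0) n (τ.var 2) := by
  have h1 : Terminates (.assign 2 (.num 1)) σ 2 fun τ => τ = σ.setVar 2 1 :=
    ⟨_, _, .assign σ _ _, le_rfl, rfl⟩
  refine (h1.seq (c' := 2 + 100 * n) fun τ _ hτ => ?_).mono (by omega) fun τ _ h => h
  have h2 : Terminates (.assign 5 (.num 1)) τ 2 fun υ => υ = τ.setVar 5 1 :=
    ⟨_, _, .assign τ _ _, le_rfl, rfl⟩
  refine h2.seq fun υ _ hυ => ?_
  have hυ0 : υ.var 0 = n := by simp [hυ, hτ, setVar_var, hσ]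
  have hυ2 : υ.var 2 = 1 := by simp [hυ, hτ, setVar_var]
  have hυ5 : υ.var 5 = 1 := by simp [hυ, setVar_var]
  have hυa : υ.arr 0 = σ.arr 0 := by simp [hυ, hτ]
  refine (Terminates.whileLt (c := 40) (fun ω => ω.var 0 = n ∧ ω.arr 0 = σ.arr 0 ∧ ω.var 5 ≤ n ∧
    ∃ m, m ≤ n ∧ IsLyndonPrefix (σ.arr 0) (ω.var 2) m ∧
      (m = ω.var 5 ∨ (ω.var 5 = n ∧ σ.arr 0 m < σ.arr 0 (m - ω.var 2))))
    (fun ω => n - ω.var 5) ⟨hυ0, hυa, by omega, 1, hn, ?_, Or.inl hυ5.symm⟩ ?_ ?_).mono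
    ?_ fun τ _ h => h
  · rw [hυ2]; exact isLyndonPrefix_one _
  · rintro ω ⟨h0, ha, h5, m, hm, hpre, hor⟩ hlt
    simp only [Expr.eval, h0] at hlt
    have hm5 : m = ω.var 5 := by rcases hor with h | h <;> omega
    subst hm5
    refine Terminates.of_exec rfl (by decide) ?_
    simp only [exec, Expr.eval, ha]
    split_ifs with h6 h7
    · simp only [setVar_var, setVar_arr, h0, ha]
      norm_num
      exact ⟨⟨_, hm, hpre, Or.inr h6⟩, by omega⟩
    · simp only [setVar_var, setVar_arr, h0, ha]
      norm_num
      exact ⟨⟨by omega, _, by omega, hpre.succ_of_lt h7, Or.inl rfl⟩, by omega⟩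
    · simp only [setVar_var, setVar_arr, h0, ha]
      norm_num
      exact ⟨⟨by omega, _, by omega, hpre.succ (by omega), Or.inl rfl⟩, by omega⟩
  · rintro ω ⟨h0, ha, h5, m, hm, hpre, hor⟩ hlt
    simp only [Expr.eval, h0] at hlt
    refine ⟨m, hm, hpre, ?_⟩
    rcases hor with h | h
    · exact Or.inl (by omega)
    · exact Or.inr h.2
  · have : (Expr.var 5).cost + (Expr.var 0).cost + 1 = 3 := rfl
    rw [this, hυ5]
    have : n - 1 + 1 = n := by omega
    rw [this]
    omega

/-! ### The program: one step of the recurrence -/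

/-- The contribution of state `p` of the forward automaton, state `q` of the backward automaton and
letter `b` to cell `c` of the next table for `walks`. Array `1` holds `x`, array `0` holds `y`,
variables `2` and `3` hold their lengths, and arrays `3` and `4` hold the tables for `walks` and
`walksNoReturn`, with row length `n`. -/
def walksTerm (σ : State) (p q b c : ℕ) : ℕ :=
  if σ.arr 1 p ≤ b ∧ σ.arr 0 q ≤ b ∧ next (σ.arr 1) (σ.var 2) p b * σ.var 0 + q = c then
    σ.arr 3 (p * σ.var 0 + next (σ.arr 0) (σ.var 3) q b) +
    if next (σ.arr 1) (σ.var 2) p b ≠ 0 then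
      σ.arr 4 (p * σ.var 0 + next (σ.arr 0) (σ.var 3) q b) else 0
  else 0

/-- The analogue of `walksTerm` for `walksNoReturn`. -/
def noReturnTerm (σ : State) (p q b c : ℕ) : ℕ :=
  if σ.arr 1 p ≤ b ∧ σ.arr 0 q ≤ b ∧ next (σ.arr 1) (σ.var 2) p b * σ.var 0 + q = c then
    if next (σ.arr 1) (σ.var 2) p b ≠ 0 then
      σ.arr 4 (p * σ.var 0 + next (σ.arr 0) (σ.var 3) q b) else 0
  else 0

/-- The state `τ` has the same parameters and the same current tables as `σ`. -/
def SameInput (σ τ : State) : Prop :=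
  (τ.var 0 = σ.var 0 ∧ τ.var 1 = σ.var 1 ∧ τ.var 2 = σ.var 2 ∧ τ.var 3 = σ.var 3) ∧
  τ.arr 0 = σ.arr 0 ∧ τ.arr 1 = σ.arr 1 ∧ τ.arr 3 = σ.arr 3 ∧ τ.arr 4 = σ.arr 4

theorem Frame.sameInput {vs as : List ℕ} {σ τ : State} (h : Frame vs as σ τ)
    (hv : 0 ∉ vs ∧ 1 ∉ vs ∧ 2 ∉ vs ∧ 3 ∉ vs) (ha : 0 ∉ as ∧ 1 ∉ as ∧ 3 ∉ as ∧ 4 ∉ as) :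
    SameInput σ τ :=
  ⟨⟨h.1 0 hv.1, h.1 1 hv.2.1, h.1 2 hv.2.2.1, h.1 3 hv.2.2.2⟩,
    h.2 0 ha.1, h.2 1 ha.2.1, h.2 3 ha.2.2.1, h.2 4 ha.2.2.2⟩

theorem SameInput.walksTerm {σ τ : State} (h : SameInput σ τ) : walksTerm τ = walksTerm σ := by
  obtain ⟨⟨h0, -, h2, h3⟩, a0, a1, a3, a4⟩ := h
  unfold EnclosingCount.walksTerm
  rw [h0, h2, h3, a0, a1, a3, a4]

theorem SameInput.noReturnTerm {σ τ : State} (h : SameInput σ τ) :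
    noReturnTerm τ = noReturnTerm σ := by
  obtain ⟨⟨h0, -, h2, h3⟩, a0, a1, a3, a4⟩ := h
  unfold EnclosingCount.noReturnTerm
  rw [h0, h2, h3, a0, a1, a4]

/-- Stores in variable `out` the successor of the state in variable `i` under the letter in
variable `10`, for the word in array `a` of length given by variable `len`. -/
def nextProg (a i len out : ℕ) : Prog :=
  .ifLt (.get a (.var i)) (.var 10) (.assign out (.num 0)) <|
    .ifLt (.add (.var i) (.num 1)) (.var len) (.assign out (.add (.var i) (.num 1)))
      (.assign out (.num 0))

theorem exec_nextProg (a i len out : ℕ) (σ : State) : exec (nextProg a i len out) σ =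
    σ.setVar out (next (σ.arr a) (σ.var len) (σ.var i) (σ.var 10)) := by
  by_cases h1 : σ.arr a (σ.var i) < σ.var 10
  · simp [nextProg, exec, next, Expr.eval, h1]
  · by_cases h2 : σ.var i + 1 < σ.var len <;> simp [nextProg, exec, next, Expr.eval, h1, h2]

/-- Adds to an entry of table `a` an entry of table `s`. -/
def addToProg (a s : ℕ) : Prog :=
  .store a (.add (.var 12) (.var 9))
    (.add (.get a (.add (.var 12) (.var 9))) (.get s (.add (.var 11) (.var 13))))

/-- Adds the contribution of the states in variables `8` and `9` and of the letter in variable `10`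
to the new tables in arrays `5` and `6`. -/
def cellProg : Prog :=
  .ifLt (.var 10) (.get 1 (.var 8)) .skip <| .ifLt (.var 10) (.get 0 (.var 9)) .skip <|
    .seq (nextProg 0 9 3 13) <| .seq (nextProg 1 8 2 23) <|
      .ifLt (.num 0) (.var 23)
        (.seq (.assign 12 (.add (.var 11) (.var 0))) <| .seq (addToProg 5 3) <|
          .seq (addToProg 5 4) (addToProg 6 4))
        (.seq (.assign 12 (.num 0)) (addToProg 5 3))

theorem next_eq_zero_or (x : ℕ → ℕ) (p q b : ℕ) : next x p q b = 0 ∨ next x p q b = q + 1 := by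
  unfold next; split_ifs <;> simp

theorem terminates_cellProg {σ : State} (hσ : σ.var 11 = σ.var 8 * σ.var 0) :
    Terminates cellProg σ 200 fun τ =>
      (∀ c, τ.arr 5 c = σ.arr 5 c + walksTerm σ (σ.var 8) (σ.var 9) (σ.var 10) c) ∧
      ∀ c, τ.arr 6 c = σ.arr 6 c + noReturnTerm σ (σ.var 8) (σ.var 9) (σ.var 10) c := by
  refine Terminates.of_exec rfl (by decide) ?_
  by_cases h1 : σ.var 10 < σ.arr 1 (σ.var 8)
  · simp [cellProg, exec, Expr.eval, h1, walksTerm, noReturnTerm]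
  by_cases h2 : σ.var 10 < σ.arr 0 (σ.var 9)
  · simp [cellProg, exec, Expr.eval, h1, h2, walksTerm, noReturnTerm]
  have h1' : σ.arr 1 (σ.var 8) ≤ σ.var 10 := not_lt.mp h1
  have h2' : σ.arr 0 (σ.var 9) ≤ σ.var 10 := not_lt.mp h2
  rcases next_eq_zero_or (σ.arr 1) (σ.var 2) (σ.var 8) (σ.var 10) with h3 | h3
  · simp only [cellProg, exec, exec_nextProg, Expr.eval, addToProg, setVar_var, setVar_arr,
      setArr_arr, setArr_var, walksTerm, noReturnTerm, h1, h2, h1', h2', h3, hσ, if_true, if_false,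
      Function.update_apply, true_and, ne_eq, not_true, lt_irrefl,
      Nat.reduceEqDiff, zero_mul, add_zero, zero_add]
    refine ⟨fun c => ?_, fun c => ?_⟩
    · by_cases hc : c = σ.var 9
      · simp [hc]
      · simp [hc, Ne.symm hc]
    · simp
  · have hidx : (σ.var 8 + 1) * σ.var 0 + σ.var 9 = σ.var 8 * σ.var 0 + σ.var 0 + σ.var 9 := by ring
    simp only [cellProg, exec, exec_nextProg, Expr.eval, addToProg, setVar_var, setVar_arr,
      setArr_arr, setArr_var, walksTerm, noReturnTerm, h1, h2, h1', h2', h3, hσ, if_true, if_false,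
      Function.update_apply, true_and, ne_eq, Nat.succ_pos, hidx,
      Nat.reduceEqDiff, Nat.succ_ne_zero, not_false_eq_true]
    refine ⟨fun c => ?_, fun c => ?_⟩
    · by_cases hc : c = σ.var 8 * σ.var 0 + σ.var 0 + σ.var 9
      · simp [hc, add_assoc]
      · simp [hc, Ne.symm hc]
    · by_cases hc : c = σ.var 8 * σ.var 0 + σ.var 0 + σ.var 9
      · simp [hc]
      · simp [hc, Ne.symm hc]

/-- Adds the contributions of all letters. -/
def letterLoop : Prog := forLt 10 1 cellProg

/-- Adds the contributions of all states of the backward automaton. -/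
def columnLoop : Prog := forLt 9 3 letterLoop

/-- Adds the contributions of all states of the forward automaton. Variable `11` is the offset of
the current row of the tables. -/
def rowLoop : Prog :=
  .seq (.assign 11 (.num 0)) <|
    forLt 8 2 (.seq columnLoop (.assign 11 (.add (.var 11) (.var 0))))

/-- Between `σ` and `τ`, the numbers `f c` and `g c` were added to the cells `c` of the new
tables. -/
def AddedToTables (f g : ℕ → ℕ) (σ τ : State) : Prop :=
  (∀ c, τ.arr 5 c = σ.arr 5 c + f c) ∧ ∀ c, τ.arr 6 c = σ.arr 6 c + g c

theorem terminates_letterLoop {σ : State} {k : ℕ} (hσ : σ.var 11 = σ.var 8 * σ.var 0)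
    (h1 : σ.var 1 = k) (hk : 1 ≤ k) :
    Terminates letterLoop σ (4000 * k) (AddedToTables
      (fun c => ∑ b ∈ Finset.range k, walksTerm σ (σ.var 8) (σ.var 9) b c)
      (fun c => ∑ b ∈ Finset.range k, noReturnTerm σ (σ.var 8) (σ.var 9) b c) σ) := by
  refine (Terminates.forLt (c := 200) (M := k) (fun j τ => AddedToTables
      (fun c => ∑ b ∈ Finset.range j, walksTerm σ (σ.var 8) (σ.var 9) b c)
      (fun c => ∑ b ∈ Finset.range j, noReturnTerm σ (σ.var 8) (σ.var 9) b c) σ τ)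
    (by norm_num) h1.le hk (by decide) (by decide) ?_ ?_ fun τ _ h => h1 ▸ h).mono (by omega)
    fun τ _ h => h
  · simp [AddedToTables]
  · intro j hj τ hf hi hI
    have h8 := hf.1 8 (by decide)
    have h9 := hf.1 9 (by decide)
    have hin : SameInput σ τ := hf.sameInput (by decide) (by decide)
    refine (terminates_cellProg (σ := τ) ?_).mono le_rfl fun υ _ h => ?_
    · rw [h8, hf.1 11 (by decide), hf.1 0 (by decide), hσ]
    · rw [hin.walksTerm, hin.noReturnTerm, h8, h9, hi] at h
      simp only [AddedToTables, setVar_arr, Finset.sum_range_succ]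
      exact ⟨fun c => by rw [h.1, hI.1, add_assoc], fun c => by rw [h.2, hI.2, add_assoc]⟩

theorem terminates_columnLoop {σ : State} {n k : ℕ} (hσ : σ.var 11 = σ.var 8 * σ.var 0)
    (h1 : σ.var 1 = k) (hk : 1 ≤ k) (h3 : σ.var 3 ≤ n) (hn : 1 ≤ n) :
    Terminates columnLoop σ (80000 * (n * k)) (AddedToTables
      (fun c => ∑ q ∈ Finset.range (σ.var 3), ∑ b ∈ Finset.range k, walksTerm σ (σ.var 8) q b c)
      (fun c => ∑ q ∈ Finset.range (σ.var 3), ∑ b ∈ Finset.range k,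
        noReturnTerm σ (σ.var 8) q b c) σ) := by
  refine (Terminates.forLt (c := 4000 * k) (M := n) (fun j τ => AddedToTables
      (fun c => ∑ q ∈ Finset.range j, ∑ b ∈ Finset.range k, walksTerm σ (σ.var 8) q b c)
      (fun c => ∑ q ∈ Finset.range j, ∑ b ∈ Finset.range k, noReturnTerm σ (σ.var 8) q b c) σ τ)
    (by omega) h3 hn (by decide) (by decide) ?_ ?_ fun τ _ h => h).mono
    (by nlinarith) fun τ _ h => h
  · simp [AddedToTables]
  · intro j hj τ hf hi hI
    have h8 := hf.1 8 (by decide)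
    have hin : SameInput σ τ := hf.sameInput (by decide) (by decide)
    refine (terminates_letterLoop (σ := τ) (k := k) ?_ ?_ hk).mono le_rfl fun υ _ h => ?_
    · rw [h8, hf.1 11 (by decide), hf.1 0 (by decide), hσ]
    · rw [hin.1.2.1, h1]
    · rw [hin.walksTerm, hin.noReturnTerm, h8, hi] at h
      simp only [AddedToTables, setVar_arr, Finset.sum_range_succ] at h ⊢
      exact ⟨fun c => by rw [h.1, hI.1, add_assoc], fun c => by rw [h.2, hI.2, add_assoc]⟩

theorem terminates_rowLoop {σ : State} {n k : ℕ} (h1 : σ.var 1 = k) (hk : 1 ≤ k)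
    (h2 : σ.var 2 ≤ n) (h3 : σ.var 3 ≤ n) (hn : 1 ≤ n) :
    Terminates rowLoop σ (2000000 * (n * n * k)) (AddedToTables
      (fun c => ∑ p ∈ Finset.range (σ.var 2), ∑ q ∈ Finset.range (σ.var 3),
        ∑ b ∈ Finset.range k, walksTerm σ p q b c)
      (fun c => ∑ p ∈ Finset.range (σ.var 2), ∑ q ∈ Finset.range (σ.var 3),
        ∑ b ∈ Finset.range k, noReturnTerm σ p q b c) σ) := by
  have hnk : 1 ≤ n * k := Nat.mul_pos hn hk
  have hnnk : 1 ≤ n * n * k := Nat.mul_pos (Nat.mul_pos hn hn) hk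
  have hfirst : Terminates (.assign 11 (.num 0)) σ 2 fun τ => τ = σ.setVar 11 0 :=
    ⟨_, _, .assign σ _ _, le_rfl, rfl⟩
  refine (hfirst.seq (c' := 20 * (n * (80005 * (n * k)))) fun ρ hfρ hρ => ?_).mono
    (by nlinarith) fun τ _ h => h
  have hinρ : SameInput σ ρ := hfρ.sameInput (by decide) (by decide)
  have hρa : ρ.arr = σ.arr := by rw [hρ]; rfl
  refine (Terminates.forLt (c := 80005 * (n * k)) (M := n) (fun j τ =>
      τ.var 11 = j * σ.var 0 ∧ AddedToTables
      (fun c => ∑ p ∈ Finset.range j, ∑ q ∈ Finset.range (σ.var 3),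
        ∑ b ∈ Finset.range k, walksTerm σ p q b c)
      (fun c => ∑ p ∈ Finset.range j, ∑ q ∈ Finset.range (σ.var 3),
        ∑ b ∈ Finset.range k, noReturnTerm σ p q b c) σ τ)
    (by omega) (by rw [hinρ.1.2.2.1]; exact h2) hn (by decide) (by decide) ?_ ?_
    fun τ _ h => hinρ.1.2.2.1 ▸ h.2).mono
    le_rfl fun τ _ h => h
  · simp [AddedToTables, setVar_var, hρ]
  · intro j hj τ hf hi hI
    have hin : SameInput σ τ := by
      have := hf.sameInput (by decide) (by decide)
      exact ⟨⟨this.1.1.trans hinρ.1.1, this.1.2.1.trans hinρ.1.2.1,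
        this.1.2.2.1.trans hinρ.1.2.2.1, this.1.2.2.2.trans hinρ.1.2.2.2⟩,
        this.2.1.trans hinρ.2.1, this.2.2.1.trans hinρ.2.2.1,
        this.2.2.2.1.trans hinρ.2.2.2.1, this.2.2.2.2.trans hinρ.2.2.2.2⟩
    refine ((terminates_columnLoop (σ := τ) (n := n) (k := k) ?_ ?_ hk ?_ hn).seq (c' := 4)
      fun υ hfυ hυ => ?_).mono (by omega) fun _ _ h => h
    · rw [hI.1, hi, hin.1.1]
    · rw [hin.1.2.1, h1]
    · rw [hin.1.2.2.2]; exact h3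
    · rw [hin.walksTerm, hin.noReturnTerm, hi, hin.1.2.2.2] at hυ
      refine ⟨_, _, .assign υ _ _, by decide, ?_⟩
      have h11 : υ.var 11 = τ.var 11 := hfυ.1 11 (by decide)
      have h0 : υ.var 0 = τ.var 0 := hfυ.1 0 (by decide)
      refine ⟨?_, ?_⟩
      · simp only [setVar_var, Expr.eval, h11, h0, hI.1, hin.1.1]
        norm_num
        ring
      · have hI2 := hI.2
        simp only [AddedToTables, setVar_arr, Finset.sum_range_succ] at hI2 hυ ⊢
        exact ⟨fun c => by rw [hυ.1, hI2.1, add_assoc], fun c => by rw [hυ.2, hI2.2, add_assoc]⟩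

/-! ### The program: counting closed words of all lengths -/

/-- Clears the tables in arrays `a` and `b`. Variable `15` is their size. -/
def clearProg (a b : ℕ) : Prog :=
  forLt 14 15 (.seq (.store a (.var 14) (.num 0)) (.store b (.var 14) (.num 0)))

/-- Moves the new tables to the current tables. -/
def copyProg : Prog :=
  forLt 14 15 (.seq (.store 3 (.var 14) (.get 5 (.var 14))) (.store 4 (.var 14) (.get 6 (.var 14))))

theorem terminates_clearProg {σ : State} {M a b : ℕ} (hab : a ≠ b) (hM : σ.var 15 = M)
    (hM1 : 1 ≤ M) : Terminates (clearProg a b) σ (400 * M) fun τ =>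
      ∀ c < M, τ.arr a c = 0 ∧ τ.arr b c = 0 := by
  refine (Terminates.forLt (c := 20) (M := M)
    (fun j τ => ∀ c < j, τ.arr a c = 0 ∧ τ.arr b c = 0)
    (by norm_num) hM.le hM1 (by simp [assigned]) (by simp [assigned]) ?_ ?_
    fun τ _ h => hM ▸ h).mono (by omega) fun τ _ h => h
  · simp
  · intro j hj τ hf hi hI
    refine Terminates.of_exec rfl (by simp [timeBound, Expr.cost]) fun c hc => ?_
    simp only [exec, Expr.eval, setArr_arr, setArr_var, setVar_arr, hi, if_neg hab,
      if_neg hab.symm, if_true, Function.update_apply]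
    rcases Nat.lt_succ_iff_lt_or_eq.mp hc with h | rfl
    · rw [if_neg h.ne, if_neg h.ne]; exact hI c h
    · simp

theorem terminates_copyProg {σ : State} {M : ℕ} (hM : σ.var 15 = M) (hM1 : 1 ≤ M) :
    Terminates copyProg σ (400 * M) fun τ =>
      ∀ c < M, τ.arr 3 c = σ.arr 5 c ∧ τ.arr 4 c = σ.arr 6 c := by
  refine (Terminates.forLt (c := 20) (M := M)
    (fun j τ => ∀ c < j, τ.arr 3 c = σ.arr 5 c ∧ τ.arr 4 c = σ.arr 6 c)
    (by norm_num) hM.le hM1 (by decide) (by decide) ?_ ?_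
    fun τ _ h => hM ▸ h).mono (by omega) fun τ _ h => h
  · simp
  · intro j hj τ hf hi hI
    refine Terminates.of_exec rfl (by decide) fun c hc => ?_
    have h5 : τ.arr 5 = σ.arr 5 := hf.2 5 (by decide)
    have h6 : τ.arr 6 = σ.arr 6 := hf.2 6 (by decide)
    simp only [exec, Expr.eval, setArr_arr, setArr_var, setVar_arr, hi, h5, h6, Nat.reduceEqDiff,
      if_false, if_true, Function.update_apply]
    rcases Nat.lt_succ_iff_lt_or_eq.mp hc with h | rfl
    · rw [if_neg h.ne, if_neg h.ne]; exact hI c h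
    · simp

/-- Replaces the tables for words of length `t` by those for words of length `t + 1`. -/
def stepProg : Prog := .seq (clearProg 5 6) (.seq rowLoop copyProg)

/-- The current tables hold the numbers of walks of length `t` for initial state `q₀`. -/
def HoldsWalks (σ : State) (q₀ t : ℕ) : Prop :=
  ∀ r < σ.var 2, ∀ q < σ.var 3,
    σ.arr 3 (r * σ.var 0 + q) =
      walks (σ.arr 1) (σ.var 2) (σ.arr 0) (σ.var 3) (σ.var 1) q₀ t r q ∧
    σ.arr 4 (r * σ.var 0 + q) =
      walksNoReturn (σ.arr 1) (σ.var 2) (σ.arr 0) (σ.var 3) (σ.var 1) q₀ t r q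

theorem index_eq_iff {n r r' q q' : ℕ} (hq : q < n) (hq' : q' < n) :
    r * n + q = r' * n + q' ↔ r = r' ∧ q = q' := by
  constructor
  · intro h
    have h1 : (r * n + q) / n = r := by
      rw [mul_comm, Nat.mul_add_div (by omega), Nat.div_eq_of_lt hq, add_zero]
    have h2 : (r' * n + q') / n = r' := by
      rw [mul_comm, Nat.mul_add_div (by omega), Nat.div_eq_of_lt hq', add_zero]
    have h3 : r = r' := by rw [← h1, h, h2]
    subst h3
    exact ⟨rfl, by omega⟩
  · rintro ⟨rfl, rfl⟩; rfl

/-- The step program evaluates `walks_succ` and `walksNoReturn_succ` for all cells. -/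
theorem terminates_stepProg {σ : State} {n q₀ t : ℕ} (h0 : σ.var 0 = n) (hk : 1 ≤ σ.var 1)
    (h2 : σ.var 2 ≤ n) (h2' : 0 < σ.var 2) (h3 : σ.var 3 ≤ n) (hn : 1 ≤ n)
    (h15 : σ.var 15 = n * n) (hσ : HoldsWalks σ q₀ t) :
    Terminates stepProg σ (3000000 * (n * n * σ.var 1)) fun τ => HoldsWalks τ q₀ (t + 1) := by
  have hnn : 1 ≤ n * n := Nat.mul_pos hn hn
  have hnnk : n * n ≤ n * n * σ.var 1 := Nat.le_mul_of_pos_right _ hk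
  refine ((terminates_clearProg (by norm_num) h15 hnn).seq
    (c' := 2000000 * (n * n * σ.var 1) + 400 * (n * n)) fun ρ hfρ hρ => ?_).mono (by omega)
    fun _ _ h => h
  have hin : SameInput σ ρ := hfρ.sameInput (by decide) (by decide)
  obtain ⟨⟨e0, e1, e2, e3⟩, a0, a1, a3, a4⟩ := hin
  refine (terminates_rowLoop (n := n) e1 hk (by omega) (by omega) hn).seq fun υ hfυ hυ => ?_
  have h15' : υ.var 15 = n * n := by
    rw [hfυ.1 15 (by decide), hfρ.1 15 (by decide), h15]
  refine (terminates_copyProg h15' hnn).mono le_rfl fun τ hfτ hτ => ?_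
  have hv : ∀ x, x ∈ [0, 1, 2, 3] → τ.var x = σ.var x := by
    intro x hx
    have hx' : x = 0 ∨ x = 1 ∨ x = 2 ∨ x = 3 := by simpa using hx
    rcases hx' with rfl | rfl | rfl | rfl
    all_goals rw [hfτ.1 _ (by decide), hfυ.1 _ (by decide), hfρ.1 _ (by decide)]
  have ha : ∀ x, x ∈ [0, 1] → τ.arr x = σ.arr x := by
    intro x hx
    have hx' : x = 0 ∨ x = 1 := by simpa using hx
    rcases hx' with rfl | rfl
    all_goals rw [hfτ.2 _ (by decide), hfυ.2 _ (by decide), hfρ.2 _ (by decide)]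
  intro r hr q hq
  rw [hv 2 (by decide)] at hr
  rw [hv 3 (by decide)] at hq
  rw [hv 0 (by decide), hv 1 (by decide), hv 2 (by decide), hv 3 (by decide), ha 0 (by decide),
    ha 1 (by decide), h0]
  have hlt : r * n + q < n * n := by
    have : (r + 1) * n ≤ n * n := Nat.mul_le_mul_right _ (by omega)
    rw [Nat.succ_mul] at this
    omega
  -- only the column of `q` contributes to a cell in this column
  have hcol : ∀ p b q', q' ∈ Finset.range (σ.var 3) → q' ≠ q →
      ¬ (σ.arr 1 p ≤ b ∧ σ.arr 0 q' ≤ b ∧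
        next (σ.arr 1) (σ.var 2) p b * n + q' = r * n + q) := by
    rintro p b q' hq' hne ⟨-, -, h⟩
    exact hne ((index_eq_iff (by have := Finset.mem_range.mp hq'; omega) (by omega)).mp h).2
  have hiff : ∀ p b, (next (σ.arr 1) (σ.var 2) p b * n + q = r * n + q) ↔
      next (σ.arr 1) (σ.var 2) p b = r := fun p b => by
    rw [index_eq_iff (by omega) (by omega)]; simp
  have hlt3 : ∀ b, next (σ.arr 0) (σ.var 3) q b < σ.var 3 := fun b => next_lt (by omega) _ _
  obtain ⟨t1, t2⟩ := hτ _ hlt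
  obtain ⟨c1, c2⟩ := hρ _ hlt
  rw [t1, t2, hυ.1, hυ.2, c1, c2, zero_add, zero_add, e2, e3,
    SameInput.walksTerm ⟨⟨e0, e1, e2, e3⟩, a0, a1, a3, a4⟩,
    SameInput.noReturnTerm ⟨⟨e0, e1, e2, e3⟩, a0, a1, a3, a4⟩]
  rw [walks_succ h2', walksNoReturn_succ h2']
  constructor
  · refine Finset.sum_congr rfl fun p hp => ?_
    have hp' := Finset.mem_range.mp hp
    rw [Finset.sum_eq_single_of_mem q (Finset.mem_range.mpr hq)]
    · refine Finset.sum_congr rfl fun b _ => ?_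
      have hw := hσ p hp' _ (hlt3 b)
      rw [h0] at hw
      simp only [walksTerm, h0, hiff, hw.1, hw.2]
    · intro q' hq' hne
      refine Finset.sum_eq_zero fun b _ => ?_
      rw [walksTerm, h0, if_neg (hcol p b q' hq' hne)]
  · refine Finset.sum_congr rfl fun p hp => ?_
    have hp' := Finset.mem_range.mp hp
    rw [Finset.sum_eq_single_of_mem q (Finset.mem_range.mpr hq)]
    · refine Finset.sum_congr rfl fun b _ => ?_
      have hw := hσ p hp' _ (hlt3 b)
      rw [h0] at hw
      simp only [noReturnTerm, h0, hiff, hw.2]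
    · intro q' hq' hne
      refine Finset.sum_eq_zero fun b _ => ?_
      rw [noReturnTerm, h0, if_neg (hcol p b q' hq' hne)]

/-- Initializes the tables for walks of length `0` and the initial state in variable `6`. -/
def startProg : Prog :=
  .seq (clearProg 3 4) (.seq (.store 3 (.var 6) (.num 1)) (.store 4 (.var 6) (.num 1)))

/-- Runs through the lengths `t + 1 = 1, …, n` and adds to entry `t + 1` of array `7` the number of
walks that return to their initial state. -/
def lengthLoop : Prog :=
  forLt 7 0 <| .seq stepProg <|
    .store 7 (.add (.var 7) (.num 1))
      (.add (.get 7 (.add (.var 7) (.num 1))) (.get 3 (.var 6)))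

/-- Computes in array `7` the numbers of closed words of the lengths `1, …, n`. -/
def closedWordsProg : Prog :=
  .seq (forLt 14 0 (.store 7 (.add (.var 14) (.num 1)) (.num 0)))
    (forLt 6 3 (.seq startProg lengthLoop))

/-- The state `τ` has the same alphabet size, word length and Lyndon words as `σ`. -/
def SameWords (σ τ : State) : Prop :=
  (τ.var 0 = σ.var 0 ∧ τ.var 1 = σ.var 1 ∧ τ.var 2 = σ.var 2 ∧ τ.var 3 = σ.var 3 ∧
    τ.var 15 = σ.var 15) ∧ τ.arr 0 = σ.arr 0 ∧ τ.arr 1 = σ.arr 1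

theorem Frame.sameWords {vs as : List ℕ} {σ τ : State} (h : Frame vs as σ τ)
    (hv : 0 ∉ vs ∧ 1 ∉ vs ∧ 2 ∉ vs ∧ 3 ∉ vs ∧ 15 ∉ vs) (ha : 0 ∉ as ∧ 1 ∉ as) :
    SameWords σ τ :=
  ⟨⟨h.1 0 hv.1, h.1 1 hv.2.1, h.1 2 hv.2.2.1, h.1 3 hv.2.2.2.1, h.1 15 hv.2.2.2.2⟩,
    h.2 0 ha.1, h.2 1 ha.2⟩

/-- The number of walks of length `d` from initial state `q₀` that return to it. -/
def closedWalks (σ : State) (q₀ d : ℕ) : ℕ :=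
  walks (σ.arr 1) (σ.var 2) (σ.arr 0) (σ.var 3) (σ.var 1) q₀ d 0 q₀

theorem SameWords.closedWalks {σ τ : State} (h : SameWords σ τ) :
    closedWalks τ = closedWalks σ := by
  obtain ⟨⟨h0, h1, h2, h3, -⟩, a0, a1⟩ := h
  funext q₀ d
  rw [EnclosingCount.closedWalks, EnclosingCount.closedWalks, h1, h2, h3, a0, a1]

/-- The parameters in `σ` are admissible: the two words are Lyndon words of length at most `n`, and
the size of the tables is `n * n`. -/
structure Admissible (σ : State) (n k : ℕ) : Prop where
  length_eq : σ.var 0 = n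
  letters_eq : σ.var 1 = k
  size_eq : σ.var 15 = n * n
  length_pos : 1 ≤ n
  letters_pos : 1 ≤ k
  left_le : σ.var 2 ≤ n
  right_le : σ.var 3 ≤ n
  left_lyndon : IsLyndon (σ.arr 1) (σ.var 2)
  right_lyndon : IsLyndon (σ.arr 0) (σ.var 3)

theorem SameWords.admissible {σ τ : State} {n k : ℕ} (h : SameWords σ τ) (hσ : Admissible σ n k) :
    Admissible τ n k := by
  obtain ⟨⟨h0, h1, h2, h3, h15⟩, a0, a1⟩ := h
  obtain ⟨b1, b2, b3, b4, b5, b6, b7, b8, b9⟩ := hσ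
  refine ⟨by rw [h0, b1], by rw [h1, b2], by rw [h15, b3], b4, b5, by rw [h2]; exact b6,
    by rw [h3]; exact b7, by rw [h2, a1]; exact b8, by rw [h3, a0]; exact b9⟩

theorem terminates_startProg {σ : State} {n k : ℕ} (hσ : Admissible σ n k)
    (h6 : σ.var 6 < σ.var 3) :
    Terminates startProg σ (500 * (n * n)) fun τ => HoldsWalks τ (σ.var 6) 0 := by
  have hnn : 1 ≤ n * n := Nat.mul_pos hσ.length_pos hσ.length_pos
  refine ((terminates_clearProg (by norm_num) hσ.size_eq hnn).seq (c' := 20)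
    fun ρ hfρ hρ => Terminates.of_exec rfl (by decide) ?_).mono (by omega) fun _ _ h => h
  have hs : SameWords σ ρ := hfρ.sameWords (by decide) (by decide)
  have e6 : ρ.var 6 = σ.var 6 := hfρ.1 6 (by decide)
  intro r hr q hq
  simp only [exec, Expr.eval, setArr_arr, setArr_var, Nat.reduceEqDiff, if_true, if_false,
    Function.update_apply, e6] at hr hq ⊢
  obtain ⟨⟨e0, e1, e2, e3, -⟩, -⟩ := hs
  have b6 := hσ.left_le
  have b7 := hσ.right_le
  rw [e2] at hr
  rw [e3] at hq
  rw [e0, hσ.length_eq, walks_zero, walksNoReturn_zero]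
  have hlt : r * n + q < n * n := by
    have : (r + 1) * n ≤ n * n := Nat.mul_le_mul_right _ (by omega)
    rw [Nat.succ_mul] at this
    omega
  have hiff : r * n + q = σ.var 6 ↔ r = 0 ∧ q = σ.var 6 := by
    have := index_eq_iff (n := n) (r := r) (r' := 0) (q := q) (q' := σ.var 6) (by omega) (by omega)
    rwa [zero_mul, zero_add] at this
  simp only [hiff, (hρ _ hlt).1, (hρ _ hlt).2, and_self]

theorem terminates_lengthLoop {σ : State} {n k : ℕ} (hσ : Admissible σ n k)
    (h6 : σ.var 6 < σ.var 3) (hw : HoldsWalks σ (σ.var 6) 0) :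
    Terminates lengthLoop σ (80000000 * (n * (n * n * k))) fun τ =>
      ∀ d, 1 ≤ d → d ≤ n → τ.arr 7 d = σ.arr 7 d + closedWalks σ (σ.var 6) d := by
  have hnn : 1 ≤ n * n := Nat.mul_pos hσ.length_pos hσ.length_pos
  have hnnk : 1 ≤ n * n * k := Nat.mul_pos hnn hσ.letters_pos
  refine (Terminates.forLt (c := 4000000 * (n * n * k)) (M := n)
    (fun j τ => HoldsWalks τ (σ.var 6) j ∧ ∀ d, 1 ≤ d →
      τ.arr 7 d = σ.arr 7 d + if d ≤ j then closedWalks σ (σ.var 6) d else 0)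
    (by omega) hσ.length_eq.le hσ.length_pos (by decide) (by decide) ?_ ?_ ?_).mono
    (le_of_eq (by ring)) fun τ _ h => h
  · refine ⟨fun r hr q hq => ?_, fun d hd => ?_⟩
    · simpa [setVar_var] using hw r (by simpa [setVar_var] using hr) q
        (by simpa [setVar_var] using hq)
    · rw [if_neg (by omega)]; rfl
  · rintro j hj τ hf hi ⟨hI1, hI2⟩
    have hs : SameWords σ τ := hf.sameWords (by decide) (by decide)
    have hτ := hs.admissible hσ
    have e6 : τ.var 6 = σ.var 6 := hf.1 6 (by decide)
    refine ((terminates_stepProg (n := n) hτ.length_eq (by rw [hτ.letters_eq]; exact hτ.letters_pos)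
      hτ.left_le hτ.left_lyndon.1 hτ.right_le hτ.length_pos hτ.size_eq hI1).seq (c' := 20)
      fun υ hfυ hυ => Terminates.of_exec rfl (by decide) ?_).mono
      (by rw [hτ.letters_eq]; omega) fun _ _ h => h
    have hs' : SameWords τ υ := hfυ.sameWords (by decide) (by decide)
    have hυ' := hs'.admissible hτ
    have f7 : υ.arr 7 = τ.arr 7 := hfυ.2 7 (by decide)
    have f6 : υ.var 6 = σ.var 6 := (hfυ.1 6 (by decide)).trans e6
    have g7 : υ.var 7 = j := (hfυ.1 7 (by decide)).trans hi
    have hcell : υ.arr 3 (σ.var 6) = closedWalks σ (σ.var 6) (j + 1) := by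
      have h := (hυ 0 hυ'.left_lyndon.1 (σ.var 6) (by rw [hs'.1.2.2.2.1, hs.1.2.2.2.1]; exact h6)).1
      rw [zero_mul, zero_add] at h
      rw [h, ← hs.closedWalks, ← hs'.closedWalks, closedWalks]
    refine ⟨fun r hr q hq => ?_, fun d hd => ?_⟩
    · simp only [exec, Expr.eval, setArr_arr, setArr_var, setVar_var, setVar_arr,
        Nat.reduceEqDiff, if_false, OfNat.zero_ne_ofNat, OfNat.one_ne_ofNat] at hr hq ⊢
      exact hυ r hr q hq
    · simp only [exec, Expr.eval, setArr_arr, setVar_arr, if_true, Function.update_apply, g7, f7,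
        f6, hcell]
      rcases eq_or_ne d (j + 1) with rfl | hne
      · rw [if_pos rfl, hI2 _ hd, if_neg (by omega), if_pos le_rfl, add_zero]
      · rw [if_neg hne, hI2 d hd]
        congr 1
        exact if_congr (by omega) rfl rfl
  · rintro τ - ⟨-, h⟩ d hd hdn
    rw [h d hd, hσ.length_eq, if_pos hdn]

theorem terminates_closedWordsProg {σ : State} {n k : ℕ} (hσ : Admissible σ n k) :
    Terminates closedWordsProg σ (2000000000 * (n * (n * (n * n * k)))) fun τ =>
      ∀ d, 1 ≤ d → d ≤ n → τ.arr 7 d =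
        (closedWords (σ.arr 1) (σ.var 2) (σ.arr 0) (σ.var 3) k d).card := by
  have hn := hσ.length_pos
  have hnn : 1 ≤ n * n := Nat.mul_pos hn hn
  have hnnk : n * n ≤ n * n * k := Nat.le_mul_of_pos_right _ hσ.letters_pos
  have hn3 : n * n * k ≤ n * (n * n * k) := Nat.le_mul_of_pos_left _ hn
  have hn4 : n * (n * n * k) ≤ n * (n * (n * n * k)) := Nat.le_mul_of_pos_left _ hn
  have hnle : n ≤ n * n := Nat.le_mul_of_pos_left _ hn
  have hclear : Terminates (forLt 14 0 (.store 7 (.add (.var 14) (.num 1)) (.num 0))) σ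
      (400 * n) fun τ => ∀ d, 1 ≤ d → d ≤ n → τ.arr 7 d = 0 := by
    refine (Terminates.forLt (c := 20) (M := n) (fun j τ => ∀ d, 1 ≤ d → d ≤ j → τ.arr 7 d = 0)
      (by norm_num) hσ.length_eq.le hn (by decide) (by decide) ?_ ?_
      fun τ _ h => hσ.length_eq ▸ h).mono (by omega) fun τ _ h => h
    · intro d hd hd'; omega
    · intro j hj τ hf hi hI
      refine Terminates.of_exec rfl (by decide) fun d hd hdj => ?_
      simp only [exec, Expr.eval, setArr_arr, setVar_arr, if_true, Function.update_apply, hi]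
      split_ifs with h
      · rfl
      · exact hI d hd (by omega)
  refine (hclear.seq (c' := 20 * (n * (90000000 * (n * (n * n * k))))) fun ρ hfρ hρ => ?_).mono
    (by
      have : 20 * (n * (90000000 * (n * (n * n * k)))) =
        1800000000 * (n * (n * (n * n * k))) := by ring
      omega) fun _ _ h => h
  have hs : SameWords σ ρ := hfρ.sameWords (by decide) (by decide)
  refine Terminates.forLt (fun j τ => ∀ d, 1 ≤ d → d ≤ n →
      τ.arr 7 d = ∑ q ∈ Finset.range j, closedWalks σ q d)
    (by omega) (by rw [hs.1.2.2.2.1]; exact hσ.right_le) hn (by decide) (by decide) ?_ ?_ ?_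
  · intro d hd hdn
    rw [setVar_arr, hρ d hd hdn, Finset.sum_range_zero]
  · intro j hj τ hf hi hI
    have hs' : SameWords ρ τ := hf.sameWords (by decide) (by decide)
    have hτ := hs'.admissible (hs.admissible hσ)
    have h6 : τ.var 6 < τ.var 3 := by rw [hi, hs'.1.2.2.2.1]; exact hj
    refine ((terminates_startProg hτ h6).seq (c' := 80000000 * (n * (n * n * k)))
      fun υ hfυ hυ => ?_).mono (by omega) fun _ _ h => h
    have hs'' : SameWords τ υ := hfυ.sameWords (by decide) (by decide)
    have e6 : υ.var 6 = τ.var 6 := hfυ.1 6 (by decide)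
    have e7 : υ.arr 7 = τ.arr 7 := hfυ.2 7 (by decide)
    refine (terminates_lengthLoop (hs''.admissible hτ) (by rw [e6, hs''.1.2.2.2.1]; exact h6)
      (e6 ▸ hυ)).mono le_rfl fun ω _ hω d hd hdn => ?_
    rw [setVar_arr, hω d hd hdn, e7, e6, hi, hI d hd hdn, hs''.closedWalks, hs'.closedWalks,
      hs.closedWalks, Finset.sum_range_succ]
  · intro τ _ h d hd hdn
    rw [h d hd hdn, hs.1.2.2.2.1, ← sum_walks_eq_card hσ.left_lyndon hσ.right_lyndon k hd]
    simp only [closedWalks, hσ.letters_eq]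

/-! ### The program: summation over the rotations -/

/-- Computes in variable `19` the greatest common divisor of variables `20` and `0`. -/
def gcdProg : Prog :=
  .seq (.assign 18 (.var 20)) <| .seq (.assign 19 (.var 0)) <| .whileLt (.num 0) (.var 18) <|
    .ifLt (.var 18) (.var 19) (.assign 19 (.sub (.var 19) (.var 18)))
      (.assign 18 (.sub (.var 18) (.var 19)))

theorem terminates_gcdProg {σ : State} {n : ℕ} (h0 : σ.var 0 = n) (hn : 1 ≤ n)
    (h20 : σ.var 20 < n) :
    Terminates gcdProg σ (200 * n) fun τ => τ.var 19 = Nat.gcd (σ.var 20) n := by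
  have h1 : Terminates (.assign 18 (.var 20)) σ 2 fun τ => τ = σ.setVar 18 (σ.var 20) :=
    ⟨_, _, .assign σ _ _, le_rfl, rfl⟩
  refine (h1.seq (c' := 2 + 190 * n) fun τ _ hτ => ?_).mono (by omega) fun τ _ h => h
  have h2 : Terminates (.assign 19 (.var 0)) τ 2 fun υ => υ = τ.setVar 19 (τ.var 0) :=
    ⟨_, _, .assign τ _ _, le_rfl, rfl⟩
  refine h2.seq fun υ _ hυ => ?_
  have h18 : υ.var 18 = σ.var 20 := by simp [hυ, hτ, setVar_var]
  have h19 : υ.var 19 = n := by simp [hυ, hτ, setVar_var, h0]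
  refine (Terminates.whileLt (c := 30)
    (fun ω => 0 < ω.var 19 ∧ Nat.gcd (ω.var 18) (ω.var 19) = Nat.gcd (σ.var 20) n)
    (fun ω => ω.var 18 + ω.var 19) ⟨by omega, by rw [h18, h19]⟩ ?_ ?_).mono ?_ fun τ _ h => h
  · rintro ω ⟨hpos, hg⟩ hlt
    simp only [Expr.eval] at hlt
    refine Terminates.of_exec rfl (by decide) ?_
    rw [exec]
    split_ifs with h
    · simp only [Expr.eval] at h
      simp only [exec, Expr.eval, setVar_var]
      norm_num
      exact ⟨⟨h, by rw [Nat.gcd_sub_self_right h.le, hg]⟩, by omega⟩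
    · simp only [Expr.eval, not_lt] at h
      simp only [exec, Expr.eval, setVar_var]
      norm_num
      exact ⟨⟨hpos, by rw [Nat.gcd_sub_self_left h, hg]⟩, by omega⟩
  · rintro ω ⟨hpos, hg⟩ hlt
    simp only [Expr.eval] at hlt
    have h3 : ω.var 18 = 0 := by omega
    rw [← hg, h3, Nat.gcd_zero_left]
  · have : (Expr.num 0).cost + (Expr.var 18).cost + 1 = 3 := rfl
    rw [this, h18, h19]
    omega

/-- Computes in variable `16` the sum over all rotations of the numbers of closed words that they
fix. -/
def fixedSumProg : Prog :=
  .seq closedWordsProg <| .seq (.assign 16 (.num 0)) <| forLt 20 0 <|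
    .seq gcdProg (.assign 16 (.add (.var 16) (.get 7 (.var 19))))

theorem terminates_fixedSumProg {σ : State} {n k : ℕ} (hσ : Admissible σ n k) :
    Terminates fixedSumProg σ (3000000000 * (n * (n * (n * n * k)))) fun τ =>
      τ.var 16 = ∑ j ∈ Finset.range n,
        (closedWords (σ.arr 1) (σ.var 2) (σ.arr 0) (σ.var 3) k (Nat.gcd j n)).card := by
  have hn := hσ.length_pos
  have hnnk : n * n ≤ n * n * k := Nat.le_mul_of_pos_right _ hσ.letters_pos
  have hn3 : n * n * k ≤ n * (n * n * k) := Nat.le_mul_of_pos_left _ hn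
  have hn4 : n * (n * n * k) ≤ n * (n * (n * n * k)) := Nat.le_mul_of_pos_left _ hn
  have hnn : 1 ≤ n * n := Nat.mul_pos hn hn
  refine ((terminates_closedWordsProg hσ).seq (c' := 2 + 20 * (n * (220 * n)))
    fun ρ hfρ hρ => ?_).mono (by
      have : 20 * (n * (220 * n)) = 4400 * (n * n) := by ring
      omega) fun _ _ h => h
  have h1 : Terminates (.assign 16 (.num 0)) ρ 2 fun τ => τ = ρ.setVar 16 0 :=
    ⟨_, _, .assign ρ _ _, le_rfl, rfl⟩
  refine h1.seq fun υ hfυ hυ => ?_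
  have h0 : υ.var 0 = n := by
    rw [hfυ.1 0 (by decide), hfρ.1 0 (by decide), hσ.length_eq]
  have h7 : υ.arr 7 = ρ.arr 7 := hfυ.2 7 (by decide)
  refine Terminates.forLt (fun j τ => τ.var 16 = ∑ j ∈ Finset.range j,
        (closedWords (σ.arr 1) (σ.var 2) (σ.arr 0) (σ.var 3) k (Nat.gcd j n)).card)
    (by omega) h0.le hn (by decide) (by decide) ?_ ?_ fun τ _ h => h0 ▸ h
  · simp [hυ, setVar_var]
  · intro j hj τ hf hi hI
    rw [h0] at hj
    have h0' : τ.var 0 = n := (hf.1 0 (by decide)).trans h0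
    refine ((terminates_gcdProg h0' hn (by omega)).seq (c' := 20) fun ω hfω hω =>
      Terminates.of_exec rfl (by decide) ?_).mono (by omega) fun _ _ h => h
    have h16 : ω.var 16 = τ.var 16 := hfω.1 16 (by decide)
    have h7' : ω.arr 7 = ρ.arr 7 := ((hfω.2 7 (by decide)).trans (hf.2 7 (by decide))).trans h7
    simp only [exec, Expr.eval, setVar_var, Nat.reduceEqDiff, if_false, if_true]
    rw [h16, hI, h7', hω, hi, hρ _ (Nat.gcd_pos_of_pos_right _ hn) (Nat.gcd_le_right _ hn),
      Finset.sum_range_succ]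

/-! ### The program: division by the length -/

/-- Divides variable `16` by variable `0` by binary long division, if the quotient is smaller than
`2 ^ (n * k)`; the result replaces variable `0`. Array `8` holds the numbers `n * 2 ^ j`, and
variable `21` is `n * k`. -/
def divProg : Prog :=
  .seq (.assign 21 (.num 0)) <|
  .seq (forLt 24 1 (.assign 21 (.add (.var 21) (.var 0)))) <|
  .seq (.store 8 (.num 0) (.var 0)) <|
  .seq (forLt 24 21 (.store 8 (.add (.var 24) (.num 1))
    (.add (.get 8 (.var 24)) (.get 8 (.var 24))))) <|
  .seq (.assign 22 (.num 0)) <|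
  .seq (forLt 24 21 (.seq (.assign 22 (.add (.var 22) (.var 22))) <|
    .ifLt (.var 16) (.get 8 (.sub (.sub (.var 21) (.var 24)) (.num 1))) .skip <|
      .seq (.assign 16 (.sub (.var 16) (.get 8 (.sub (.sub (.var 21) (.var 24)) (.num 1)))))
        (.assign 22 (.add (.var 22) (.num 1)))))
    (.assign 0 (.var 22))

theorem terminates_divProg {σ : State} {n k X : ℕ} (h0 : σ.var 0 = n) (h1 : σ.var 1 = k)
    (hn : 1 ≤ n) (hk : 1 ≤ k) (h16 : σ.var 16 = X * n) (hX : X < 2 ^ (n * k)) :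
    Terminates divProg σ (4000 * (n * k)) fun τ => τ.var 0 = X := by
  have hnk : 1 ≤ n * k := Nat.mul_pos hn hk
  have hkn : k ≤ n * k := Nat.le_mul_of_pos_left _ hn
  have a1 : Terminates (.assign 21 (.num 0)) σ 2 fun τ => τ = σ.setVar 21 0 :=
    ⟨_, _, .assign σ _ _, le_rfl, rfl⟩
  refine (a1.seq (c' := 400 * k + (4 + (400 * (n * k) + (2 + (1200 * (n * k) + 2)))))
    fun σ₁ f1 e1 => ?_).mono (by omega) fun τ _ h => h
  have a2 : Terminates (forLt 24 1 (.assign 21 (.add (.var 21) (.var 0)))) σ₁ (400 * k)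
      fun τ => τ.var 21 = n * k := by
    have h1' : σ₁.var 1 = k := (f1.1 1 (by decide)).trans h1
    refine (Terminates.forLt (c := 20) (M := k) (fun j τ => τ.var 21 = n * j)
      (by norm_num) h1'.le hk (by decide) (by decide) ?_ ?_ fun τ _ h => h1' ▸ h).mono
      (by omega) fun τ _ h => h
    · simp [e1, setVar_var]
    · intro j hj τ hf hi hI
      refine Terminates.of_exec rfl (by decide) ?_
      have h0' : τ.var 0 = n := by rw [hf.1 0 (by decide), f1.1 0 (by decide), h0]
      simp only [exec, Expr.eval, setVar_var, Nat.reduceEqDiff, if_false, if_true]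
      rw [hI, h0', Nat.mul_succ]
  refine a2.seq fun σ₂ f2 e2 => ?_
  have a3 : Terminates (.store 8 (.num 0) (.var 0)) σ₂ 4 fun τ => τ.arr 8 0 = n := by
    refine Terminates.of_exec rfl (by decide) ?_
    simp [exec, Expr.eval, setArr_arr, f2.1 0 (by decide), f1.1 0 (by decide), h0]
  refine a3.seq fun σ₃ f3 e3 => ?_
  have h21 : σ₃.var 21 = n * k := by rw [f3.1 21 (by decide), e2]
  have a4 : Terminates (forLt 24 21 (.store 8 (.add (.var 24) (.num 1))
      (.add (.get 8 (.var 24)) (.get 8 (.var 24))))) σ₃ (400 * (n * k))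
      fun τ => ∀ i ≤ n * k, τ.arr 8 i = n * 2 ^ i := by
    refine (Terminates.forLt (c := 20) (M := n * k) (fun j τ => ∀ i ≤ j, τ.arr 8 i = n * 2 ^ i)
      (by norm_num) h21.le hnk (by decide) (by decide) ?_ ?_ fun τ _ h => h21 ▸ h).mono
      (by omega) fun τ _ h => h
    · intro i hi
      rw [Nat.le_zero.mp hi, setVar_arr, e3, pow_zero, mul_one]
    · intro j hj τ hf hi hI
      refine Terminates.of_exec rfl (by decide) fun i hij => ?_
      simp only [exec, Expr.eval, setArr_arr, setVar_arr, if_true, Function.update_apply, hi]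
      split_ifs with h
      · rw [h, hI j le_rfl, pow_succ]; ring
      · exact hI i (by omega)
  refine a4.seq fun σ₄ f4 e4 => ?_
  have a5 : Terminates (.assign 22 (.num 0)) σ₄ 2 fun τ => τ = σ₄.setVar 22 0 :=
    ⟨_, _, .assign σ₄ _ _, le_rfl, rfl⟩
  refine a5.seq fun σ₅ f5 e5 => ?_
  have h21' : σ₅.var 21 = n * k := by
    rw [f5.1 21 (by decide), f4.1 21 (by decide), h21]
  have h16' : σ₅.var 16 = X * n := by
    rw [f5.1 16 (by decide), f4.1 16 (by decide), f3.1 16 (by decide), f2.1 16 (by decide),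
      f1.1 16 (by decide), h16]
  have h8 : ∀ i ≤ n * k, σ₅.arr 8 i = n * 2 ^ i := fun i hi => by
    rw [f5.2 8 (by decide), e4 i hi]
  have a6 : Terminates (forLt 24 21 (.seq (.assign 22 (.add (.var 22) (.var 22))) <|
      .ifLt (.var 16) (.get 8 (.sub (.sub (.var 21) (.var 24)) (.num 1))) .skip <|
      .seq (.assign 16 (.sub (.var 16) (.get 8 (.sub (.sub (.var 21) (.var 24)) (.num 1)))))
        (.assign 22 (.add (.var 22) (.num 1))))) σ₅ (1200 * (n * k)) fun τ => τ.var 22 = X := by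
    -- variable `22` is the quotient by `n * 2 ^ (n * k - j)`, and variable `16` the remainder
    refine (Terminates.forLt (c := 60) (M := n * k) (fun j τ =>
        X * n = τ.var 22 * (n * 2 ^ (n * k - j)) + τ.var 16 ∧ τ.var 16 < n * 2 ^ (n * k - j))
      (by norm_num) h21'.le hnk (by decide) (by decide) ?_ ?_ ?_).mono (by omega) fun τ _ h => h
    · simp only [setVar_var, Nat.reduceEqDiff, if_false, e5, if_true]
      have : σ₄.var 16 = X * n := by
        rw [← h16', e5]; simp [setVar_var]
      rw [this, Nat.sub_zero]
      refine ⟨by ring, ?_⟩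
      rw [mul_comm]
      exact Nat.mul_lt_mul_of_pos_left hX hn
    · rintro j hj τ hf hi ⟨hI1, hI2⟩
      rw [h21'] at hj
      have g21 : τ.var 21 = n * k := (hf.1 21 (by decide)).trans h21'
      have g8 : τ.arr 8 (n * k - j - 1) = n * 2 ^ (n * k - (j + 1)) := by
        rw [hf.2 8 (by decide), h8 _ (by omega), Nat.sub_sub]
      have hpow : n * 2 ^ (n * k - j) = 2 * (n * 2 ^ (n * k - (j + 1))) := by
        rw [show n * k - j = n * k - (j + 1) + 1 by omega, pow_succ]; ring
      rw [hpow] at hI1 hI2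
      refine Terminates.of_exec rfl (by decide) ?_
      by_cases hlt : τ.var 16 < n * 2 ^ (n * k - (j + 1))
      · simp only [exec, Expr.eval, setVar_var, setVar_arr, Nat.reduceEqDiff, if_false, if_true,
          g21, hi, g8, hlt]
        exact ⟨by rw [hI1]; ring, trivial⟩
      · simp only [exec, Expr.eval, setVar_var, setVar_arr, Nat.reduceEqDiff, if_false, if_true,
          g21, hi, g8, hlt]
        refine ⟨?_, by omega⟩
        obtain ⟨s, hs⟩ := Nat.exists_eq_add_of_le (not_lt.mp hlt)
        rw [hI1, hs, Nat.add_sub_cancel_left]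
        ring
    · rintro τ - ⟨h2, h3⟩
      rw [h21', Nat.sub_self, pow_zero, mul_one] at h2 h3
      have : X * n / n = (τ.var 22 * n + τ.var 16) / n := by rw [h2]
      rw [Nat.mul_div_cancel _ hn, mul_comm (τ.var 22), Nat.mul_add_div hn,
        Nat.div_eq_of_lt h3, add_zero] at this
      exact this.symm
  refine a6.seq fun σ₆ _ e6 => ⟨_, _, .assign σ₆ _ _, le_rfl, ?_⟩
  simp [setVar_var, Expr.eval, e6]

/-! ### The complete program -/

/-- Copies the first `n` cells of array `a` to array `b`. -/
def copyArrayProg (a b : ℕ) : Prog := forLt 14 0 (.store b (.var 14) (.get a (.var 14)))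

theorem terminates_copyArrayProg {σ : State} {n a b : ℕ} (hab : a ≠ b) (h0 : σ.var 0 = n)
    (hn : 1 ≤ n) : Terminates (copyArrayProg a b) σ (400 * n) fun τ =>
      ∀ c, τ.arr b c = if c < n then σ.arr a c else σ.arr b c := by
  refine (Terminates.forLt (c := 20) (M := n)
    (fun j τ => ∀ c, τ.arr b c = if c < j then σ.arr a c else σ.arr b c)
    (by norm_num) h0.le hn (by simp [assigned]) (by simp [assigned]) ?_ ?_
    fun τ _ h => h0 ▸ h).mono (by omega) fun τ _ h => h
  · simp
  · intro j hj τ hf hi hI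
    refine Terminates.of_exec rfl (by simp [timeBound, Expr.cost]) fun c => ?_
    have ha : τ.arr a = σ.arr a := hf.2 a (by simpa [stored] using hab)
    simp only [exec, Expr.eval, setArr_arr, setVar_arr, if_true, Function.update_apply, hi, ha, hI]
    rcases lt_trichotomy c j with h | rfl | h
    · rw [if_neg h.ne, if_pos h, if_pos (by omega)]
    · rw [if_pos rfl, if_pos (by omega)]
    · rw [if_neg h.ne', if_neg (by omega), if_neg (by omega)]

/-- Computes `n * n` in variable `15`. -/
def squareProg : Prog :=
  .seq (.assign 15 (.num 0)) (forLt 14 0 (.assign 15 (.add (.var 15) (.var 0))))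

theorem terminates_squareProg {σ : State} {n : ℕ} (h0 : σ.var 0 = n) (hn : 1 ≤ n) :
    Terminates squareProg σ (500 * n) fun τ => τ.var 15 = n * n := by
  have a1 : Terminates (.assign 15 (.num 0)) σ 2 fun τ => τ = σ.setVar 15 0 :=
    ⟨_, _, .assign σ _ _, le_rfl, rfl⟩
  refine (a1.seq (c' := 20 * (n * 20)) fun ρ f1 e1 => ?_).mono (by omega) fun τ _ h => h
  have h0' : ρ.var 0 = n := (f1.1 0 (by decide)).trans h0
  refine Terminates.forLt (fun j τ => τ.var 15 = n * j)
    (by norm_num) h0'.le hn (by decide) (by decide) ?_ ?_ fun τ _ h => h0' ▸ h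
  · simp [e1, setVar_var]
  · intro j hj τ hf hi hI
    refine Terminates.of_exec rfl (by decide) ?_
    have h0'' : τ.var 0 = n := (hf.1 0 (by decide)).trans h0'
    simp only [exec, Expr.eval, setVar_var, Nat.reduceEqDiff, if_false, if_true]
    rw [hI, h0'', Nat.mul_succ]

/-- Computes the Lyndon roots of the input word `v` (length in variable `4`) and of `v` with its
last letter increased (length in variable `3`), and saves `v` in array `2`. The empty array `1` and
length `1` in variable `2` provide the Lyndon word `0`, whose automaton accepts every word. -/
def setupProg : Prog :=
  .seq lyndonRootProg <| .seq (.assign 4 (.var 2)) <| .seq (copyArrayProg 0 2) <|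
  .seq (.store 0 (.sub (.var 0) (.num 1)) (.add (.get 0 (.sub (.var 0) (.num 1))) (.num 1))) <|
  .seq lyndonRootProg <| .seq (.seq (.assign 3 (.var 2)) (.assign 2 (.num 1))) squareProg

/-- The number of enclosing bracelets: the words whose reversals have all rotations larger than
`v` are counted first, those that in addition have no rotation smaller than `v` are subtracted,
and the result is divided by the length. -/
def enclosingProg : Prog :=
  .seq setupProg <| .seq fixedSumProg <| .seq (.assign 17 (.var 16)) <| .seq (copyArrayProg 2 1) <|
  .seq (.assign 2 (.var 4)) <| .seq fixedSumProg <|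
  .seq (.assign 16 (.sub (.var 17) (.var 16))) divProg

theorem IsLyndonRoot.le {v : ℕ → ℕ} {n p : ℕ} (h : IsLyndonRoot v n p) : p ≤ n := by
  obtain ⟨m, h1, h2, -⟩ := h
  exact h2.2.1.trans h1

theorem terminates_setupProg {σ : State} {n k : ℕ} {v : ℕ → ℕ} (h0 : σ.var 0 = n)
    (h1 : σ.var 1 = k) (hn : 1 ≤ n) (hk : 1 ≤ k) (a0 : σ.arr 0 = v) (a1 : σ.arr 1 = fun _ => 0)
    (a2 : σ.arr 2 = fun _ => 0) (hv : ∀ c, n ≤ c → v c = 0) :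
    Terminates setupProg σ (2000 * n) fun τ =>
      Admissible τ n k ∧ IsLyndonRoot v n (τ.var 4) ∧ IsLyndonRoot (bump v n) n (τ.var 3) ∧
      τ.arr 0 = bump v n ∧ τ.arr 1 = (fun _ => 0) ∧ τ.arr 2 = v ∧ τ.var 2 = 1 := by
  refine ((terminates_lyndonRootProg h0 hn).seq (c' := 2 + (400 * n + (20 + (200 * n +
    (20 + 500 * n))))) fun σ₁ f1 e1 => ?_).mono (by omega) fun _ _ h => h
  have s2 : Terminates (.assign 4 (.var 2)) σ₁ 2 fun τ => τ.var 4 = σ₁.var 2 :=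
    Terminates.of_exec rfl (by decide) (by simp [exec, Expr.eval, setVar_var])
  refine s2.seq fun σ₂ f2 e2 => ?_
  have g0 : σ₂.var 0 = n := by rw [f2.1 0 (by decide), f1.1 0 (by decide), h0]
  refine (terminates_copyArrayProg (by norm_num) g0 hn).seq fun σ₃ f3 e3 => ?_
  have b2 : σ₃.arr 2 = v := by
    funext c
    rw [e3, f2.2 0 (by decide), f2.2 2 (by decide), f1.2 0 (by decide), f1.2 2 (by decide), a0, a2]
    split_ifs with h
    · rfl
    · exact (hv c (by omega)).symm
  have g0' : σ₃.var 0 = n := (f3.1 0 (by decide)).trans g0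
  have b0 : σ₃.arr 0 = v := by
    rw [f3.2 0 (by decide), f2.2 0 (by decide), f1.2 0 (by decide), a0]
  have s4 : Terminates (.store 0 (.sub (.var 0) (.num 1))
      (.add (.get 0 (.sub (.var 0) (.num 1))) (.num 1))) σ₃ 20 fun τ => τ.arr 0 = bump v n :=
    Terminates.of_exec rfl (by decide) (by
      simp only [exec, Expr.eval, setArr_arr, if_true, g0', b0]; rfl)
  refine s4.seq fun σ₄ f4 e4 => ?_
  have g0'' : σ₄.var 0 = n := (f4.1 0 (by decide)).trans g0'
  refine (terminates_lyndonRootProg g0'' hn).seq fun σ₅ f5 e5 => ?_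
  have s6 : Terminates (.seq (.assign 3 (.var 2)) (.assign 2 (.num 1))) σ₅ 20
      fun τ => τ.var 3 = σ₅.var 2 ∧ τ.var 2 = 1 :=
    Terminates.of_exec rfl (by decide) (by simp [exec, Expr.eval, setVar_var])
  refine s6.seq fun σ₆ f6 e6 => ?_
  have g0''' : σ₆.var 0 = n := by rw [f6.1 0 (by decide), f5.1 0 (by decide), g0'']
  refine (terminates_squareProg g0''' hn).mono le_rfl fun τ f7 e7 => ?_
  have t2 : τ.var 2 = 1 := (f7.1 2 (by decide)).trans e6.2
  have t3 : τ.var 3 = σ₅.var 2 := (f7.1 3 (by decide)).trans e6.1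
  have t4 : τ.var 4 = σ₁.var 2 := by
    rw [f7.1 4 (by decide), f6.1 4 (by decide), f5.1 4 (by decide), f4.1 4 (by decide),
      f3.1 4 (by decide), e2]
  have r0 : τ.arr 0 = bump v n := by
    rw [f7.2 0 (by decide), f6.2 0 (by decide), f5.2 0 (by decide), e4]
  have r1 : τ.arr 1 = fun _ => 0 := by
    rw [f7.2 1 (by decide), f6.2 1 (by decide), f5.2 1 (by decide), f4.2 1 (by decide),
      f3.2 1 (by decide), f2.2 1 (by decide), f1.2 1 (by decide), a1]
  have r2 : τ.arr 2 = v := by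
    rw [f7.2 2 (by decide), f6.2 2 (by decide), f5.2 2 (by decide), f4.2 2 (by decide), b2]
  have t0 : τ.var 0 = n := (f7.1 0 (by decide)).trans g0'''
  have t1 : τ.var 1 = k := by
    rw [f7.1 1 (by decide), f6.1 1 (by decide), f5.1 1 (by decide), f4.1 1 (by decide),
      f3.1 1 (by decide), f2.1 1 (by decide), f1.1 1 (by decide), h1]
  rw [a0, ← t4] at e1
  rw [e4, ← t3] at e5
  exact ⟨⟨t0, t1, e7, hn, hk, by omega, e5.le, by rw [r1, t2]; exact isLyndon_zero,
    by rw [r0]; exact e5.isLyndon⟩, e1, e5, r0, r1, r2, t2⟩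

theorem terminates_enclosingProg {A : Type*} [LinearOrder A] [Fintype A] {n : ℕ} {v : List A}
    (hn : 1 ≤ n) (hv : v.length = n) :
    Terminates enclosingProg (inputState v)
      (7000000000 * (n * (n * (n * n * Fintype.card A)))) fun τ =>
      τ.var 0 = (Bracelets.enclosingBracelets n v).ncard := by
  have hk : 1 ≤ Fintype.card A :=
    Fintype.card_pos_iff.mpr ⟨v[0]'(by omega)⟩
  set k := Fintype.card A with hkdef
  have hnk : n ≤ n * k := Nat.le_mul_of_pos_right _ hk
  have hnnk : n * k ≤ n * (n * k) := Nat.le_mul_of_pos_left _ hn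
  have hn3 : n * n * k ≤ n * (n * n * k) := Nat.le_mul_of_pos_left _ hn
  have hn4 : n * (n * n * k) ≤ n * (n * (n * n * k)) := Nat.le_mul_of_pos_left _ hn
  have hassoc : n * (n * k) = n * n * k := (mul_assoc _ _ _).symm
  have hcode : ∀ c, n ≤ c → code v c = 0 := fun c hc =>
    List.getD_eq_default _ _ (by simpa [hv] using hc)
  have hsetup := terminates_setupProg (σ := inputState v) (n := n) (k := k) (v := code v)
    (by simp [inputState, hv]) (by simp [inputState, hkdef]) hn hk
    (by funext i; simp [inputState, code]) (by funext i; simp [inputState])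
    (by funext i; simp [inputState]) hcode
  refine (hsetup.seq (c' := 3000000000 * (n * (n * (n * n * k))) + (2 + (400 * n + (2 +
    (3000000000 * (n * (n * (n * n * k))) + (4 + 4000 * (n * k)))))))
    fun σ₁ f1 e1 => ?_).mono (by omega) fun _ _ h => h
  obtain ⟨hadm, hx, hy, a0, a1, a2, v2⟩ := e1
  refine (terminates_fixedSumProg hadm).seq fun σ₂ f2 e2 => ?_
  have s3 : Terminates (.assign 17 (.var 16)) σ₂ 2 fun τ => τ.var 17 = σ₂.var 16 :=
    Terminates.of_exec rfl (by decide) (by simp [exec, Expr.eval, setVar_var])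
  refine s3.seq fun σ₃ f3 e3 => ?_
  have w0 : σ₃.var 0 = n := by rw [f3.1 0 (by decide), f2.1 0 (by decide), hadm.length_eq]
  refine (terminates_copyArrayProg (by norm_num) w0 hn).seq fun σ₄ f4 e4 => ?_
  have b1 : σ₄.arr 1 = code v := by
    funext c
    rw [e4, f3.2 2 (by decide), f2.2 2 (by decide), a2, f3.2 1 (by decide), f2.2 1 (by decide), a1]
    split_ifs with h
    · rfl
    · exact (hcode c (by omega)).symm
  have s5 : Terminates (.assign 2 (.var 4)) σ₄ 2 fun τ => τ.var 2 = σ₄.var 4 :=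
    Terminates.of_exec rfl (by decide) (by simp [exec, Expr.eval, setVar_var])
  refine s5.seq fun σ₅ f5 e5 => ?_
  have v2' : σ₅.var 2 = σ₁.var 4 := by
    rw [e5, f4.1 4 (by decide), f3.1 4 (by decide), f2.1 4 (by decide)]
  have c1 : σ₅.arr 1 = code v := (f5.2 1 (by decide)).trans b1
  have hvar : ∀ x, x ∈ [0, 1, 3, 15] → σ₅.var x = σ₁.var x := by
    intro x hx
    have hx' : x = 0 ∨ x = 1 ∨ x = 3 ∨ x = 15 := by simpa using hx
    rcases hx' with rfl | rfl | rfl | rfl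
    all_goals rw [f5.1 _ (by decide), f4.1 _ (by decide), f3.1 _ (by decide), f2.1 _ (by decide)]
  have c0 : σ₅.arr 0 = bump (code v) n := by
    rw [f5.2 0 (by decide), f4.2 0 (by decide), f3.2 0 (by decide), f2.2 0 (by decide), a0]
  have hadm' : Admissible σ₅ n k :=
    ⟨(hvar 0 (by decide)).trans hadm.length_eq, (hvar 1 (by decide)).trans hadm.letters_eq,
      (hvar 15 (by decide)).trans hadm.size_eq, hn, hk, by rw [v2']; exact hx.le,
      by rw [hvar 3 (by decide)]; exact hy.le, by rw [c1, v2']; exact hx.isLyndon,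
      by rw [c0, hvar 3 (by decide)]; exact hy.isLyndon⟩
  refine (terminates_fixedSumProg hadm').seq fun σ₆ f6 e6 => ?_
  have s7 : Terminates (.assign 16 (.sub (.var 17) (.var 16))) σ₆ 4
      fun τ => τ.var 16 = σ₆.var 17 - σ₆.var 16 :=
    Terminates.of_exec rfl (by decide) (by simp [exec, Expr.eval, setVar_var])
  refine s7.seq fun σ₇ f7 e7 => ?_
  have h17 : σ₆.var 17 = σ₂.var 16 := by
    rw [f6.1 17 (by decide), f5.1 17 (by decide), f4.1 17 (by decide), e3]
  rw [a0, a1, v2] at e2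
  rw [c0, c1, v2', hvar 3 (by decide)] at e6
  have hsum := sum_card_closedWords hn hv hx hy
  rw [← hkdef, ← e2, ← e6] at hsum
  have h16 : σ₇.var 16 = (Bracelets.enclosingBracelets n v).ncard * n := by
    rw [e7, h17, hsum, Nat.add_sub_cancel]
  refine (terminates_divProg (n := n) (k := k) ?_ ?_ hn hk h16 ?_).mono le_rfl fun _ _ h => h
  · rw [f7.1 0 (by decide), f6.1 0 (by decide), hadm'.length_eq]
  · rw [f7.1 1 (by decide), f6.1 1 (by decide), hadm'.letters_eq]
  · -- every summand is at most `k ^ n`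
    have hle : σ₂.var 16 ≤ n * k ^ n := by
      rw [e2]
      refine (Finset.sum_le_sum (g := fun _ => k ^ n) fun j _ => ?_).trans (by simp)
      refine (Finset.card_le_card fun u hu => (mem_closedWords.mp hu).1).trans
        ((card_words_le _ _).trans ?_)
      exact Nat.pow_le_pow_right hk (Nat.gcd_le_right _ hn)
    have h1 : (Bracelets.enclosingBracelets n v).ncard * n ≤ k ^ n * n := by
      rw [mul_comm (k ^ n)]; omega
    calc (Bracelets.enclosingBracelets n v).ncard ≤ k ^ n := Nat.le_of_mul_le_mul_right h1 hn
      _ < (2 ^ k) ^ n := Nat.pow_lt_pow_left Nat.lt_two_pow_self (by omega)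
      _ = 2 ^ (n * k) := by rw [← pow_mul, mul_comm]

end EnclosingCount

theorem mainTheorem4 :
    ∃ (P : RAM.Prog) (C : ℕ),
      ∀ (A : Type*) [LinearOrder A] [Fintype A] (n : ℕ) (v : List A),
        1 ≤ n → v.length = n →
        ∃ (τ : RAM.State) (t : ℕ),
          RAM.Run P (RAM.inputState v) τ t ∧
          t ≤ C * (n ^ 4 * Fintype.card A ^ 2) ∧
          τ.var 0 = (Bracelets.enclosingBracelets n v).ncard := by
  refine ⟨EnclosingCount.enclosingProg, 7000000000, fun A _ _ n v hn hv => ?_⟩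
  obtain ⟨τ, t, h1, h2, h3⟩ := EnclosingCount.terminates_enclosingProg hn hv
  refine ⟨τ, t, h1, h2.trans (Nat.mul_le_mul_left _ ?_), h3⟩
  calc n * (n * (n * n * Fintype.card A)) = n ^ 4 * Fintype.card A := by ring
    _ ≤ n ^ 4 * Fintype.card A ^ 2 := Nat.mul_le_mul_left _ (Nat.le_self_pow two_ne_zero _)
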